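/- A rooted planar map is a connected planar map (up to orientation-preserving homeomorphism) with a distinguished oriented edge, drawn in the plane so that the infinite face lies on the right of that edge. Let $\triangle_2=\{\Theta\}$, where $\Theta$ is the rooted triangle, and for $k\ge 1$ let $\triangle_{2(k+1)}$ be the set of rooted triangulations obtained from some $m\in\triangle_{2k}$ by choosing a finite face $f$ of $m$, adding a new vertex inside $f$ and joining it by three non-crossing edges inside $f$ to the three vertices of $f$. The elements of $\triangle_{2n}$ are the stack-triangulations with $2n$ faces. Their internal vertices are those that are not incident to the infinite face. For $n\ge 2$, let $m_n$ be a uniform random element of $\triangle_{2n}$, let $u(1)$ be the first vertex inserted in $m_n$ (it does not depend on the order of insertions used to construct $m_n$), and, given $m_n$, let $\mathbf u$ be a uniform random internal vertex of $m_n$. Then, as $n\to\infty$: (i) $\deg_{m_n}(u(1))$ converges in law to a random variable $X$ with $$\mathbb P(X=k+3)=\frac{k}{k+3}\binom{2k+2}{k}\frac{2^{k+3}}{3^{2k+3}}\qquad\text{for all } k\ge 0;$$ (ii) $\deg_{m_n}(\mathbf u)$ converges in law to a random variable $Y$ with $$\mathbb P(Y=k+3)=\frac{1}{k+3}\binom{2k+2}{k}\frac{2^{k+3}}{3^{2k+2}}\qquad\text{for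 all } k\ge 0.$$ -/

import Mathlib

open Equiv Filter Topology MeasureTheory

/-- A rooted map on an oriented surface, given by its darts (oriented edges). `next d` is the dart
that follows `d` in counterclockwise order around the origin of `d`, `rev d` is `d` with the
opposite orientation, and `root` is the distinguished oriented edge. Only the maps obtained from
a triangle in the plane by inserting vertices into faces are used below; these are connected and
planar. -/
structure RootedMap (D : Type) where
  next : Perm D
  rev : Perm D
  rev_rev : ∀ d, rev (rev d) = d
  rev_ne : ∀ d, rev d ≠ d
  root : D

namespace RootedMap

variable {D D' D'' : Type}

/-- Isomorphisms of rooted maps: orientation preserving and root preserving. -/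
structure Iso (M : RootedMap D) (N : RootedMap D') where
  toEquiv : D ≃ D'
  map_next : ∀ d, toEquiv (M.next d) = N.next (toEquiv d)
  map_rev : ∀ d, toEquiv (M.rev d) = N.rev (toEquiv d)
  map_root : toEquiv M.root = N.root

def Iso.refl (M : RootedMap D) : Iso M M := ⟨Equiv.refl D, fun _ => rfl, fun _ => rfl, rfl⟩

def Iso.symm {M : RootedMap D} {N : RootedMap D'} (e : Iso M N) : Iso N M where
  toEquiv := e.toEquiv.symm
  map_next d := by rw [Equiv.symm_apply_eq, e.map_next, Equiv.apply_symm_apply]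
  map_rev d := by rw [Equiv.symm_apply_eq, e.map_rev, Equiv.apply_symm_apply]
  map_root := by rw [Equiv.symm_apply_eq, e.map_root]

def Iso.trans {M : RootedMap D} {N : RootedMap D'} {P : RootedMap D''} (e : Iso M N)
    (e' : Iso N P) : Iso M P where
  toEquiv := e.toEquiv.trans e'.toEquiv
  map_next d := by simp [e.map_next, e'.map_next]
  map_rev d := by simp [e.map_rev, e'.map_rev]
  map_root := by simp [e.map_root, e'.map_root]

/-- Vertices: orbits of `next`. The vertex `⟦d⟧` is the origin of the dart `d`. -/
abbrev Vertex (M : RootedMap D) : Type := Quotient (Perm.SameCycle.setoid M.next)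

/-- The origin of a dart. -/
def origin (M : RootedMap D) (d : D) : M.Vertex := Quotient.mk _ d

/-- The degree of a vertex is the number of darts that leave it. -/
noncomputable def degree (M : RootedMap D) (v : M.Vertex) : ℕ := {d : D | M.origin d = v}.ncard

/-- The successor of a dart on the boundary of the face on its left. Faces are the orbits of this
permutation. -/
def face (M : RootedMap D) : Perm D := M.next⁻¹ * M.rev

/-- The dart `d` has the infinite face on its left. The infinite face is the face on the right of
the root, i.e. on the left of the reversed root. -/
def InInfiniteFace (M : RootedMap D) (d : D) : Prop := M.face.SameCycle (M.rev M.root) d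

/-- A vertex is internal if it is not incident to the infinite face. -/
def IsInternal (M : RootedMap D) (v : M.Vertex) : Prop :=
  ∀ d, M.origin d = v → ¬ M.InInfiniteFace d

/-- The rooted triangle with corners `E 0`, `E 1`, `E 2` in counterclockwise order: `(i, true)` is
the edge from `E i` to `E (i + 1)`, and `(i, false)` is the same edge from `E (i + 1)` to `E i`.
The root goes from `E 0` to `E 1`, and its left side is the finite face. -/
def triangle : RootedMap (Fin 3 × Bool) where
  next :=
    { toFun := fun p => if p.2 then (p.1 - 1, false) else (p.1 + 1, true)
      invFun := fun p => if p.2 then (p.1 - 1, false) else (p.1 + 1, true)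
      left_inv := by decide
      right_inv := by decide }
  rev :=
    { toFun := fun p => (p.1, !p.2)
      invFun := fun p => (p.1, !p.2)
      left_inv := by decide
      right_inv := by decide }
  rev_rev := by decide
  rev_ne := by decide
  root := (0, true)

/-- The six new darts of an insertion: `(i, false)` goes from the `i`-th corner of the face to the
new vertex, `(i, true)` goes from the new vertex to the `i`-th corner. This is the rotation around
the new vertex. -/
def spin : Perm (Fin 3 × Bool) where
  toFun p := if p.2 then (p.1 + 1, true) else p
  invFun p := if p.2 then (p.1 - 1, true) else p
  left_inv := by decide
  right_inv := by decide

/-- The reversal of the six new darts. -/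
def flip : Perm (Fin 3 × Bool) where
  toFun p := (p.1, !p.2)
  invFun p := (p.1, !p.2)
  left_inv := by decide
  right_inv := by decide

/-- Exchanges the dart `d` and the new dart `(i, false)`. -/
noncomputable def exch (d : D) (i : Fin 3) : Perm (D ⊕ Fin 3 × Bool) :=
  haveI : DecidableEq (D ⊕ Fin 3 × Bool) := Classical.decEq _
  swap (Sum.inl d) (Sum.inr (i, false))

/-- Insertion of a vertex in the triangular face on the left of the dart `f`. The boundary of this
face consists of `f`, `face f` and `face (face f)`, whose origins are the corners `0`, `1`, `2`.
Around each corner, the new dart to the new vertex is put just after the boundary dart, i.e. if `d`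
is the `i`-th boundary dart, then the new rotation sends `d` to `(i, false)` and `(i, false)` to
the former successor of `d`. -/
noncomputable def insertVertex (M : RootedMap D) (f : D) : RootedMap (D ⊕ Fin 3 × Bool) where
  next := Equiv.sumCongr M.next spin *
    (exch f 0 * exch (M.face f) 1 * exch (M.face (M.face f)) 2)
  rev := Equiv.sumCongr M.rev flip
  rev_rev := by
    rintro (d | p)
    · simp [M.rev_rev]
    · simp [flip]
  rev_ne := by
    rintro (d | p)
    · simp [M.rev_ne]
    · obtain ⟨i, b⟩ := p
      cases b <;> simp [flip]
  root := Sum.inl M.root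

/-- Stack-triangulations with `2 * k` faces, with arbitrary labels on the darts. -/
inductive IsStack : ℕ → {D : Type} → RootedMap D → Prop
  | base : IsStack 1 triangle
  | step {k : ℕ} {D : Type} {M : RootedMap D} (f : D) :
      IsStack k M → ¬ M.InInfiniteFace f → IsStack (k + 1) (M.insertVertex f)
  | iso {k : ℕ} {D D' : Type} {M : RootedMap D} {N : RootedMap D'} (e : Iso M N) :
      IsStack k M → IsStack k N

/-- `IsFirstInserted M v`: there is a construction of `M` from the rooted triangle, by successive
insertions of vertices in finite faces, in which `v` is the vertex that is inserted first. -/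
inductive IsFirstInserted : {D : Type} → (M : RootedMap D) → M.Vertex → Prop
  | base (f : Fin 3 × Bool) : ¬ triangle.InInfiniteFace f →
      IsFirstInserted (triangle.insertVertex f)
        ((triangle.insertVertex f).origin (Sum.inr (0, true)))
  | step {D : Type} {M : RootedMap D} (f d : D) : IsFirstInserted M (M.origin d) →
      ¬ M.InInfiniteFace f →
      IsFirstInserted (M.insertVertex f) ((M.insertVertex f).origin (Sum.inl d))
  | iso {D D' : Type} {M : RootedMap D} {N : RootedMap D'} (e : Iso M N) (d : D) :
      IsFirstInserted M (M.origin d) → IsFirstInserted N (N.origin (e.toEquiv d))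

/-- Rooted maps with `2 * n` triangular faces have `3 * n` edges, hence `6 * n` darts. Two labelled
stack-triangulations are identified if there is an isomorphism of rooted maps between them. -/
instance stackSetoid (n : ℕ) : Setoid {M : RootedMap (Fin (6 * n)) // IsStack n M} where
  r M N := Nonempty (Iso M.1 N.1)
  iseqv := ⟨fun M => ⟨Iso.refl M.1⟩, fun ⟨e⟩ => ⟨e.symm⟩, fun ⟨e⟩ ⟨e'⟩ => ⟨e.trans e'⟩⟩

end RootedMap

/-- The set of stack-triangulations with `2 * n` faces (rooted maps up to isomorphism). -/
def StackTriangulation (n : ℕ) : Type := Quotient (RootedMap.stackSetoid n)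

namespace RootedMap

variable {D D' : Type}

/-! ### The sets over which uniform choices are made are finite and not empty -/

theorem Iso.sameCycle {p : Perm D} {q : Perm D'} (e : D ≃ D') (h : ∀ d, e (p d) = q (e d))
    (a b : D) : q.SameCycle (e a) (e b) ↔ p.SameCycle a b := by
  have hq : q = e.permCongr p := by
    ext x
    simp [Equiv.permCongr_apply, h]
  have hz : ∀ z : ℤ, (q ^ z) (e a) = e ((p ^ z) a) := by
    intro z
    have : q ^ z = e.permCongr (p ^ z) := by
      rw [hq]
      exact (map_zpow e.permCongrHom p z).symm
    rw [this]
    simp [Equiv.permCongr_apply]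
  simp [Perm.SameCycle, hz]

theorem Iso.map_face {M : RootedMap D} {N : RootedMap D'} (e : Iso M N) (d : D) :
    e.toEquiv (M.face d) = N.face (e.toEquiv d) := by
  simp only [face, Perm.mul_apply]
  rw [Perm.eq_inv_iff_eq, ← e.map_next, ← e.map_rev]
  simp

theorem Iso.infinite {M : RootedMap D} {N : RootedMap D'} (e : Iso M N) (d : D) :
    N.InInfiniteFace (e.toEquiv d) ↔ M.InInfiniteFace d := by
  unfold InInfiniteFace
  rw [← e.map_root, ← e.map_rev]
  exact Iso.sameCycle e.toEquiv e.map_face _ _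

theorem origin_eq {M : RootedMap D} {a b : D} :
    M.origin a = M.origin b ↔ M.next.SameCycle a b := by
  unfold origin
  rw [Quotient.eq]
  rfl

theorem exch_of_ne {d : D} {i : Fin 3} {x : D ⊕ Fin 3 × Bool} (h : x ≠ Sum.inl d)
    (h' : x ≠ Sum.inr (i, false)) : exch d i x = x := by
  unfold exch
  exact @swap_apply_of_ne_of_ne _ (Classical.decEq _) _ _ _ h h'

theorem insert_next_inl (M : RootedMap D) {f d : D} (h0 : d ≠ f) (h1 : d ≠ M.face f)
    (h2 : d ≠ M.face (M.face f)) :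
    (M.insertVertex f).next (Sum.inl d) = Sum.inl (M.next d) := by
  simp only [insertVertex, Perm.mul_apply]
  rw [exch_of_ne (x := Sum.inl d) (by simpa using h2) (by simp),
    exch_of_ne (x := Sum.inl d) (by simpa using h1) (by simp),
    exch_of_ne (x := Sum.inl d) (by simpa using h0) (by simp)]
  rfl

theorem insert_next_new (M : RootedMap D) (f : D) (i : Fin 3) :
    (M.insertVertex f).next (Sum.inr (i, true)) = Sum.inr (i + 1, true) := by
  simp only [insertVertex, Perm.mul_apply]
  rw [exch_of_ne (x := Sum.inr (i, true)) (by simp) (by simp),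
    exch_of_ne (x := Sum.inr (i, true)) (by simp) (by simp),
    exch_of_ne (x := Sum.inr (i, true)) (by simp) (by simp)]
  rfl

theorem insert_face_inl (M : RootedMap D) {f : D} (hf : ¬ M.InInfiniteFace f) {d : D}
    (hd : M.InInfiniteFace d) : (M.insertVertex f).face (Sum.inl d) = Sum.inl (M.face d) := by
  have hd' : M.InInfiniteFace (M.face d) := Perm.sameCycle_apply_right.2 hd
  have key : ∀ g, ¬ M.InInfiniteFace g → M.face d ≠ g := fun g hg h => hg (h ▸ hd')
  have step : ∀ g, ¬ M.InInfiniteFace g → ¬ M.InInfiniteFace (M.face g) :=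
    fun g hg h => hg (Perm.sameCycle_apply_right.1 h)
  have h := M.insert_next_inl (key f hf) (key _ (step _ hf)) (key _ (step _ (step _ hf)))
  rw [face, Perm.mul_apply, Perm.inv_eq_iff_eq, h]
  simp [insertVertex, face]

/-- An insertion in a finite face does not change the infinite face. -/
theorem insert_infinite (M : RootedMap D) {f : D} (hf : ¬ M.InInfiniteFace f)
    {x : D ⊕ Fin 3 × Bool} (hx : (M.insertVertex f).InInfiniteFace x) :
    ∃ d, x = Sum.inl d ∧ M.InInfiniteFace d := by
  obtain ⟨z, rfl⟩ := hx
  have hr : (M.insertVertex f).rev (M.insertVertex f).root = Sum.inl (M.rev M.root) := rfl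
  rw [hr]
  induction z using Int.induction_on with
  | zero => exact ⟨_, rfl, Perm.SameCycle.refl _ _⟩
  | succ n ih =>
    obtain ⟨d, h, hd⟩ := ih
    refine ⟨M.face d, ?_, Perm.sameCycle_apply_right.2 hd⟩
    rw [add_comm, zpow_add, zpow_one, Perm.mul_apply, h, M.insert_face_inl hf hd]
  | pred n ih =>
    obtain ⟨d, h, hd⟩ := ih
    have hd' : M.InInfiniteFace (M.face⁻¹ d) := by
      refine Perm.sameCycle_apply_right.1 ?_
      simpa [InInfiniteFace] using hd
    refine ⟨M.face⁻¹ d, ?_, hd'⟩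
    rw [sub_eq_add_neg, add_comm, zpow_add, zpow_neg_one, Perm.mul_apply, h, Perm.inv_eq_iff_eq,
      M.insert_face_inl hf hd']
    simp

theorem insert_new_internal (M : RootedMap D) {f : D} (hf : ¬ M.InInfiniteFace f) :
    (M.insertVertex f).IsInternal ((M.insertVertex f).origin (Sum.inr (0, true))) := by
  intro x hx hinf
  obtain ⟨d, rfl, -⟩ := M.insert_infinite hf hinf
  have hc := (origin_eq.1 hx).symm
  obtain ⟨z, hz⟩ := hc
  have : ∀ z : ℤ, ∃ i, ((M.insertVertex f).next ^ z) (Sum.inr (0, true)) = Sum.inr (i, true) := by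
    intro z
    induction z using Int.induction_on with
    | zero => exact ⟨0, rfl⟩
    | succ n ih =>
      obtain ⟨i, hi⟩ := ih
      exact ⟨i + 1, by rw [add_comm, zpow_add, zpow_one, Perm.mul_apply, hi, insert_next_new]⟩
    | pred n ih =>
      obtain ⟨i, hi⟩ := ih
      refine ⟨i - 1, ?_⟩
      rw [sub_eq_add_neg, add_comm, zpow_add, zpow_neg_one, Perm.mul_apply, hi,
        Perm.inv_eq_iff_eq, insert_next_new]
      simp
  obtain ⟨i, hi⟩ := this z
  rw [hz] at hi
  cases hi

theorem Iso.internal {M : RootedMap D} {N : RootedMap D'} (e : Iso M N) {d : D}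
    (h : M.IsInternal (M.origin d)) : N.IsInternal (N.origin (e.toEquiv d)) := by
  intro x hx hinf
  obtain ⟨y, rfl⟩ := e.toEquiv.surjective x
  rw [e.infinite] at hinf
  refine h y ?_ hinf
  rw [origin_eq] at hx ⊢
  exact (Iso.sameCycle e.toEquiv e.map_next _ _).1 hx

theorem triangle_root_finite : ¬ triangle.InInfiniteFace (0, true) := by
  unfold InInfiniteFace
  rintro ⟨z, hz⟩
  have : ∀ z : ℤ, ((triangle.face ^ z) (triangle.rev triangle.root)).2 = false := by
    have h1 : ∀ p : Fin 3 × Bool, (triangle.face p).2 = p.2 := by decide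
    intro z
    induction z using Int.induction_on with
    | zero => rfl
    | succ n ih => rw [add_comm, zpow_add, zpow_one, Perm.mul_apply, h1, ih]
    | pred n ih =>
      rw [sub_eq_add_neg, add_comm, zpow_add, zpow_neg_one, Perm.mul_apply, ← h1]
      simpa using ih
  have h := this z
  rw [hz] at h
  cases h

theorem IsStack.exists_finite {k : ℕ} {D : Type} {M : RootedMap D} (h : IsStack k M) :
    ∃ f, ¬ M.InInfiniteFace f := by
  induction h with
  | base => exact ⟨_, triangle_root_finite⟩
  | step f _ hf _ =>
    refine ⟨Sum.inr (0, true), fun h => ?_⟩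
    obtain ⟨d, h, -⟩ := insert_infinite _ hf h
    cases h
  | iso e _ ih =>
    obtain ⟨f, hf⟩ := ih
    exact ⟨e.toEquiv f, fun h => hf ((e.infinite f).1 h)⟩

theorem IsStack.exists_internal {k : ℕ} {D : Type} {M : RootedMap D} (h : IsStack k M) :
    2 ≤ k → ∃ d, M.IsInternal (M.origin d) := by
  induction h with
  | base => intro h; omega
  | step f _ hf _ => exact fun _ => ⟨_, insert_new_internal _ hf⟩
  | iso e _ ih =>
    intro hk
    obtain ⟨d, hd⟩ := ih hk
    exact ⟨_, e.internal hd⟩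

theorem IsStack.one_le {k : ℕ} {D : Type} {M : RootedMap D} (h : IsStack k M) : 1 ≤ k := by
  induction h with
  | base => rfl
  | step _ _ _ _ => omega
  | iso _ _ ih => exact ih

theorem IsStack.eq_triangle {k : ℕ} {D : Type} {M : RootedMap D} (h : IsStack k M) :
    k = 1 → Nonempty (Iso triangle M) := by
  induction h with
  | base => exact fun _ => ⟨Iso.refl _⟩
  | step f h _ _ => intro hk; have := h.one_le; omega
  | iso e _ ih => exact fun hk => (ih hk).map fun e' => e'.trans e

/-- An isomorphism extends to the maps obtained by insertion in corresponding faces. -/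
theorem Iso.insert {M : RootedMap D} {N : RootedMap D'} (e : Iso M N) (f : D) :
    ∃ e' : Iso (M.insertVertex f) (N.insertVertex (e.toEquiv f)),
      ∀ p, e'.toEquiv (Sum.inr p) = Sum.inr p := by
  have hex : ∀ (d : D) (i : Fin 3) (x : D ⊕ Fin 3 × Bool),
      Equiv.sumCongr e.toEquiv (Equiv.refl _) (exch d i x) =
        exch (e.toEquiv d) i (Equiv.sumCongr e.toEquiv (Equiv.refl _) x) := by
    intro d i x
    classical
    simp only [exch, swap_apply_def]
    rcases x with x | x
    · by_cases hx : x = d <;> simp [hx]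
    · by_cases hx : x = (i, false) <;> simp [hx]
  have hs : ∀ x : D ⊕ Fin 3 × Bool,
      Equiv.sumCongr e.toEquiv (Equiv.refl _) (Equiv.sumCongr M.next spin x) =
        Equiv.sumCongr N.next spin (Equiv.sumCongr e.toEquiv (Equiv.refl _) x) := by
    rintro (x | x)
    · simp [e.map_next]
    · simp
  refine ⟨⟨Equiv.sumCongr e.toEquiv (Equiv.refl _), ?_, ?_, ?_⟩, fun p => rfl⟩
  · intro x
    simp only [insertVertex, Perm.mul_apply, ← e.map_face]
    rw [hs, hex, hex, hex]
  · rintro (x | x)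
    · simp [insertVertex, e.map_rev]
    · simp [insertVertex]
  · simp [insertVertex, e.map_root]

theorem IsStack.exists_first {k : ℕ} {D : Type} {M : RootedMap D} (h : IsStack k M) :
    2 ≤ k → ∃ d, M.IsFirstInserted (M.origin d) := by
  induction h with
  | base => intro h; omega
  | @step k D M f h hf ih =>
    intro _
    by_cases hk : k = 1
    · obtain ⟨e⟩ := h.eq_triangle hk
      obtain ⟨f, rfl⟩ := e.toEquiv.surjective f
      rw [e.infinite] at hf
      obtain ⟨e', -⟩ := e.insert f
      exact ⟨_, IsFirstInserted.iso e' _ (IsFirstInserted.base f hf)⟩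
    · obtain ⟨d, hd⟩ := ih (by have := h.one_le; omega)
      exact ⟨_, IsFirstInserted.step f d hd hf⟩
  | iso e _ ih =>
    intro hk
    obtain ⟨d, hd⟩ := ih hk
    exact ⟨_, IsFirstInserted.iso e d hd⟩

/-- A map with other labels on the darts. -/
def relabel (M : RootedMap D) (e : D ≃ D') : RootedMap D' where
  next := e.permCongr M.next
  rev := e.permCongr M.rev
  rev_rev d := by simp [Equiv.permCongr_apply, M.rev_rev]
  rev_ne d := by
    rw [Equiv.permCongr_apply, ne_eq, ← Equiv.eq_symm_apply]
    exact M.rev_ne _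
  root := e M.root

def relabelIso (M : RootedMap D) (e : D ≃ D') : Iso M (M.relabel e) where
  toEquiv := e
  map_next d := by simp [relabel, Equiv.permCongr_apply]
  map_rev d := by simp [relabel, Equiv.permCongr_apply]
  map_root := rfl

theorem exists_isStack (n : ℕ) : ∃ M : RootedMap (Fin (6 * (n + 1))), IsStack (n + 1) M := by
  induction n with
  | zero =>
    have e : Fin 3 × Bool ≃ Fin (6 * (0 + 1)) := Fintype.equivFinOfCardEq (by simp)
    exact ⟨_, IsStack.iso (triangle.relabelIso e) IsStack.base⟩
  | succ n ih =>
    obtain ⟨M, hM⟩ := ih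
    obtain ⟨f, hf⟩ := hM.exists_finite
    have e : Fin (6 * (n + 1)) ⊕ Fin 3 × Bool ≃ Fin (6 * (n + 1 + 1)) :=
      Fintype.equivFinOfCardEq (by simp; ring)
    exact ⟨_, IsStack.iso ((M.insertVertex f).relabelIso e) (IsStack.step f hM hf)⟩

instance finite [Finite D] : Finite (RootedMap D) := by
  have : Function.Injective
      (fun M : RootedMap D => ((M.next, M.rev, M.root) : Perm D × Perm D × D)) := by
    intro M N h
    cases M
    cases N
    simp_all
  exact Finite.of_injective _ this

end RootedMap

namespace StackTriangulation

/-- A labelled representative of a stack-triangulation. -/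
noncomputable def rep {n : ℕ} (t : StackTriangulation n) : RootedMap (Fin (6 * n)) :=
  (Quotient.out t).1

theorem rep_isStack {n : ℕ} (t : StackTriangulation n) : t.rep.IsStack n := (Quotient.out t).2

instance (n : ℕ) : Finite (StackTriangulation n) := Quotient.finite _

noncomputable instance (n : ℕ) : Fintype (StackTriangulation n) := Fintype.ofFinite _

instance (n : ℕ) : Nonempty (StackTriangulation (n + 1)) := by
  obtain ⟨M, hM⟩ := RootedMap.exists_isStack n
  exact ⟨Quotient.mk _ ⟨M, hM⟩⟩

/-- The set of internal vertices. -/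
def InternalVertex {n : ℕ} (t : StackTriangulation n) : Type :=
  {v : t.rep.Vertex // t.rep.IsInternal v}

instance {n : ℕ} (t : StackTriangulation n) : Finite t.InternalVertex := by
  unfold InternalVertex
  infer_instance

noncomputable instance {n : ℕ} (t : StackTriangulation n) : Fintype t.InternalVertex :=
  Fintype.ofFinite _

instance {n : ℕ} (t : StackTriangulation (n + 2)) : Nonempty t.InternalVertex := by
  obtain ⟨d, hd⟩ := t.rep_isStack.exists_internal (by omega)
  exact ⟨⟨_, hd⟩⟩

/-- There is a first inserted vertex as soon as there is more than one finite face. -/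
theorem exists_isFirstInserted {n : ℕ} (t : StackTriangulation (n + 2)) :
    ∃ v : t.rep.Vertex, t.rep.IsFirstInserted v := by
  obtain ⟨d, hd⟩ := t.rep_isStack.exists_first (by omega)
  exact ⟨_, hd⟩

/-- The law of the degree of the vertex `u t` of `t`, for a uniform stack-triangulation `t` with
`2 * (n + 2)` faces. -/
noncomputable def degreeLaw (n : ℕ) (u : ∀ t : StackTriangulation (n + 2), t.rep.Vertex) :
    PMF ℕ :=
  (PMF.uniformOfFintype (StackTriangulation (n + 2))).map fun t => t.rep.degree (u t)

/-- The law of the degree of a uniform internal vertex of a uniform stack-triangulation with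
`2 * (n + 2)` faces. -/
noncomputable def internalDegreeLaw (n : ℕ) : PMF ℕ :=
  (PMF.uniformOfFintype (StackTriangulation (n + 2))).bind fun t =>
    (PMF.uniformOfFintype t.InternalVertex).map fun v => t.rep.degree v.1

end StackTriangulation

/-- A probability mass function on the integers as an element of the space of probability measures,
which carries the topology of convergence in law. -/
noncomputable def PMF.law (p : PMF ℕ) : ProbabilityMeasure ℕ := ⟨p.toMeasure, inferInstance⟩

/-! A stack-triangulation is coded by a finite ternary tree. An insertion in the face `p` splits it
into the faces `c :: p`, so the inserted vertices form a set of words closed under taking parents,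
and the finite faces are the leaves below this set. The set does not depend on the construction: the
root fixes the outer corners, and every other vertex is recognised from the three corners of the
face that received it (`IsLabelling.tree_unique`). Hence stack-triangulations are in bijection with
ternary trees (`tree_injective`, `exists_tree_eq`), the first inserted vertex is the root node, and
an internal vertex has degree 3 plus the number of later insertions in faces incident to it.

When a vertex is inserted in a face, each corner of that face lies in exactly two of the three new
faces. The insertions that touch a given corner therefore form a binary tree inside the ternary one,
and those that touch an inserted vertex form three binary trees. Let b_k be the number of forests of
three binary trees with k nodes (`ballot 3 k`) and F(n, j) the number of forests of j ternary trees
with n nodes (`forestCard`). Each of the k binary nodes has one free ternary subtree, so among the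
trees with n + 1 nodes exactly b_k F(n - k, k) have a root of degree k + 3 (`sum_totalArm`).
Counting all nodes of that degree instead replaces F(n - k, k) by the binomial coefficient C(3(n -
k) + k, n - k) (`sum_hits`). With the closed forms `forestCard_mul` and `ballot_mul`, ratios of
binomial coefficients give the limits k b_k 2^(k+3)/3^(2k+4) and 3 b_k 2^(k+3)/3^(2k+4).

For convergence in law these limits must have total mass one. The generating function of binary
trees satisfies B = 1 + x B^2; at x = 2/9 the roots are 3/2 and 3, and the series takes the value
3/2. This gives the sums of b_k x^k and k b_k x^k (`hasSum_ballot`, `hasSum_mul_ballot`), and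
Fatou's lemma concludes (`PMF.tendsto_law`). -/

/-! ### Positions in the infinite ternary tree -/

namespace StackCode

/-- Labels of darts: `(none, i, b)` are the darts of the outer triangle and `(some p, i, b)` those
created by the insertion of a vertex in the face `p`. -/
abbrev DartLabel : Type := Option (List (Fin 3)) × Fin 3 × Bool

/-- Labels of vertices: the outer corners, and the vertices inserted in the faces `p`. -/
abbrev VertexLabel : Type := Fin 3 ⊕ List (Fin 3)

/-- The boundary darts of the face `p`. The insertion of a vertex in `p` creates the faces
`0 :: p`, `1 :: p` and `2 :: p`. -/
def side : List (Fin 3) → Fin 3 → DartLabel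
  | [], i => (none, i, true)
  | c :: p, i => ![side p c, (some p, c + 1, false), (some p, c, true)] i

/-- The corners of the face `p`. -/
def corner : List (Fin 3) → Fin 3 → VertexLabel
  | [], i => Sum.inl i
  | c :: p, i => ![corner p c, corner p (c + 1), Sum.inr p] i

/-- The origin of a dart label. -/
def source : DartLabel → VertexLabel
  | (none, i, true) => Sum.inl i
  | (none, i, false) => Sum.inl (i + 1)
  | (some p, _, true) => Sum.inr p
  | (some p, i, false) => corner p i

def reverse (u : DartLabel) : DartLabel := (u.1, u.2.1, !u.2.2)

/-- A set of nodes of the infinite ternary tree that contains the parents of its elements. -/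
def IsTree (S : Finset (List (Fin 3))) : Prop := ∀ c p, c :: p ∈ S → p ∈ S

/-- The parent of `p`, if any, belongs to `S`. -/
def IsPosition (S : Finset (List (Fin 3))) (p : List (Fin 3)) : Prop := ∀ c q, p = c :: q → q ∈ S

/-- The leaves of a tree are the finite faces of the map. -/
def IsLeaf (S : Finset (List (Fin 3))) (p : List (Fin 3)) : Prop := p ∉ S ∧ IsPosition S p

/-- The labels that occur in a map with inserted vertices `S`. -/
def InDarts (S : Finset (List (Fin 3))) (u : DartLabel) : Prop := ∀ p, u.1 = some p → p ∈ S

variable {S : Finset (List (Fin 3))}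

theorem IsTree.isPosition (hS : IsTree S) {p : List (Fin 3)} (hp : p ∈ S) : IsPosition S p := by
  rintro c q rfl
  exact hS c q hp

@[simp] theorem side_cons_zero (c : Fin 3) (p) : side (c :: p) 0 = side p c := rfl
@[simp] theorem side_cons_one (c : Fin 3) (p) : side (c :: p) 1 = (some p, c + 1, false) := rfl
@[simp] theorem side_cons_two (c : Fin 3) (p) : side (c :: p) 2 = (some p, c, true) := rfl
@[simp] theorem corner_cons_zero (c : Fin 3) (p) : corner (c :: p) 0 = corner p c := rfl
@[simp] theorem corner_cons_one (c : Fin 3) (p) : corner (c :: p) 1 = corner p (c + 1) := rfl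
@[simp] theorem corner_cons_two (c : Fin 3) (p) : corner (c :: p) 2 = Sum.inr p := rfl

theorem forall_fin_three {P : Fin 3 → Prop} (h0 : P 0) (h1 : P 1) (h2 : P 2) : ∀ i, P i
  | 0 => h0
  | 1 => h1
  | 2 => h2

theorem side_inDarts (hS : IsTree S) : ∀ (p : List (Fin 3)), IsPosition S p → ∀ i,
    InDarts S (side p i)
  | [], _, i => by intro p h; cases h
  | c :: p, hp, i => by
    have hpS : p ∈ S := hp c p rfl
    revert i
    refine forall_fin_three (side_inDarts hS p (hS.isPosition hpS) c) ?_ ?_ <;>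
    · intro q h
      cases h
      exact hpS

theorem source_side : ∀ (p : List (Fin 3)) (i : Fin 3), source (side p i) = corner p i
  | [], i => rfl
  | c :: p, i => by
    revert i
    exact forall_fin_three (source_side p c) rfl rfl

theorem source_reverse_side : ∀ (p : List (Fin 3)) (i : Fin 3),
    source (reverse (side p i)) = corner p (i + 1)
  | [], i => rfl
  | c :: p, i => by
    revert i
    exact forall_fin_three (source_reverse_side p c) rfl rfl

theorem side_ne_outer : ∀ (p : List (Fin 3)) (i j : Fin 3), side p i ≠ (none, j, false)
  | [], i, j => by simp [side]
  | c :: p, i, j => by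
    revert i
    exact forall_fin_three (side_ne_outer p c j) (by simp) (by simp)

/-- The position of a boundary dart in the face that inherits it when a vertex is inserted. -/
def descend (x : List (Fin 3) × Fin 3) : List (Fin 3) × Fin 3 := (x.2 :: x.1, 0)

/-- A dart is created at one position, and each insertion in the face that owns it hands it to side
0 of a child. The positions carrying a given dart thus form one orbit of `descend`; `home` isolates
the position of creation, and the induction on the total length climbs towards it. -/
theorem side_eq_side : ∀ (n : ℕ) (p q : List (Fin 3)) (i j : Fin 3), p.length + q.length < n →
    side p i = side q j → ∃ m, descend^[m] (p, i) = (q, j) ∨ descend^[m] (q, j) = (p, i) := by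
  have key : ∀ (x : List (Fin 3) × Fin 3) (q : List (Fin 3)) (c : Fin 3),
      (∃ m, descend^[m] x = (q, c) ∨ descend^[m] (q, c) = x) →
      ∃ m, descend^[m] x = (c :: q, 0) ∨ descend^[m] (c :: q, 0) = x := by
    rintro x q c ⟨m, h | h⟩
    · exact ⟨m + 1, Or.inl (by rw [Function.iterate_succ_apply', h]; rfl)⟩
    · cases m with
      | zero => exact ⟨1, Or.inl (by rw [← h]; rfl)⟩
      | succ m => exact ⟨m, Or.inr h⟩
  intro n
  induction n with
  | zero => intro p q i j h; omega
  | succ n ih =>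
    intro p q i j hn h
    have home : ∀ (p : List (Fin 3)) (i : Fin 3), (∃ c p', p = c :: p' ∧ i = 0) ∨
        (p = [] ∧ side p i = (none, i, true)) ∨
        (∃ c p', p = c :: p' ∧ i = 1 ∧ side p i = (some p', c + 1, false)) ∨
        (∃ c p', p = c :: p' ∧ i = 2 ∧ side p i = (some p', c, true)) := by
      rintro (_ | ⟨c, p⟩) i
      · simp [side]
      · revert i
        exact forall_fin_three (by simp) (by simp) (by simp)
    rcases home q j with ⟨c, q, rfl, rfl⟩ | hq
    · exact key _ _ _ (ih p q i c (by simp at hn; omega) (by simpa using h))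
    rcases home p i with ⟨c, p, rfl, rfl⟩ | hp
    · obtain ⟨m, h'⟩ := key _ _ _ (ih q p j c (by simp at hn; omega) (by simpa using h.symm))
      exact ⟨m, h'.symm⟩
    refine ⟨0, Or.inl ?_⟩
    rw [Function.iterate_zero, id]
    rcases hp with ⟨rfl, hp⟩ | ⟨c, p, rfl, rfl, hp⟩ | ⟨c, p, rfl, rfl, hp⟩ <;>
    rcases hq with ⟨rfl, hq⟩ | ⟨c', q, rfl, rfl, hq⟩ | ⟨c', q, rfl, rfl, hq⟩ <;>
    rw [hp, hq] at h <;> simp_all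

theorem descend_mem (hS : IsTree S) (m : ℕ) (x : List (Fin 3) × Fin 3)
    (h : IsPosition S (descend^[m + 1] x).1) : x.1 ∈ S := by
  induction m with
  | zero => exact h x.2 x.1 rfl
  | succ m ih =>
    refine ih (hS.isPosition (h (descend^[m + 1] x).2 _ ?_))
    rw [Function.iterate_succ_apply']
    rfl

/-- Different finite faces have different boundary darts. -/
theorem IsLeaf.side_inj (hS : IsTree S) {p q : List (Fin 3)} (hp : IsLeaf S p) (hq : IsLeaf S q)
    {i j : Fin 3} (h : side p i = side q j) : p = q ∧ i = j := by
  obtain ⟨m, h | h⟩ := side_eq_side _ p q i j (Nat.lt_succ_self _) h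
  all_goals
    -- If `m > 0`, the upper of the two faces has a strict descendant that is a position, hence
    -- belongs to `S` and is not a leaf.
    cases m with
    | zero =>
      rw [Function.iterate_zero, id, Prod.mk.injEq] at h
      simp [h]
    | succ m =>
      first
      | exact absurd (descend_mem hS m (p, i) (by rw [h]; exact hq.2)) hp.1
      | exact absurd (descend_mem hS m (q, j) (by rw [h]; exact hp.2)) hq.1

/-- Every dart has the infinite face or a leaf on its left. -/
theorem InDarts.cover {u : DartLabel} (hu : InDarts S u) :
    (∃ i, u = (none, i, false)) ∨ ∃ p i, IsLeaf S p ∧ u = side p i := by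
  -- Following the dart down along `descend` must leave `S`, since words longer than all nodes are
  -- outside `S`; the first face outside `S` is a leaf.
  have bound : ∀ n p i, S.sup List.length + 1 ≤ n + p.length → IsPosition S p →
      ∃ q j, IsLeaf S q ∧ side p i = side q j := by
    intro n
    induction n with
    | zero =>
      intro p i h hp
      refine ⟨p, i, ⟨fun hpS => ?_, hp⟩, rfl⟩
      have := Finset.le_sup (f := List.length) hpS
      omega
    | succ n ih =>
      intro p i h hp
      by_cases hpS : p ∈ S
      · refine ih (i :: p) 0 (by rw [List.length_cons]; omega) ?_
        rintro c q h
        cases h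
        exact hpS
      · exact ⟨p, i, ⟨hpS, hp⟩, rfl⟩
  have conclude : ∀ p i, IsPosition S p → u = side p i →
      (∃ i, u = (none, i, false)) ∨ ∃ p i, IsLeaf S p ∧ u = side p i := by
    rintro p i hp rfl
    exact Or.inr (bound (S.sup List.length + 1) p i (by omega) hp)
  obtain ⟨_ | p, i, _ | _⟩ := u
  · exact Or.inl ⟨i, rfl⟩
  · exact conclude [] i (by rintro c q h; cases h) rfl
  · refine conclude ((i - 1) :: p) 1 ?_ (by simp)
    rintro c q h
    cases h
    exact hu _ rfl
  · refine conclude (i :: p) 2 ?_ (by simp)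
    rintro c q h
    cases h
    exact hu _ rfl

/-- The inserted vertices among the corners of a face come from proper ancestors of it. The
resulting order by length drives the inductions on vertices. -/
theorem corner_eq_inr {p : List (Fin 3)} {i : Fin 3} {q : List (Fin 3)}
    (h : corner p i = Sum.inr q) : q.length < p.length := by
  induction p generalizing i with
  | nil => simp [corner] at h
  | cons c p ih =>
    rw [List.length_cons]
    revert h
    refine forall_fin_three (P := fun i => corner (c :: p) i = Sum.inr q → q.length < p.length + 1)
      (fun h => ?_) (fun h => ?_) (fun h => ?_) i
    · exact (ih h).trans (Nat.lt_succ_self _)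
    · exact (ih h).trans (Nat.lt_succ_self _)
    · cases h
      exact Nat.lt_succ_self _

theorem corner_mem (hS : IsTree S) {p : List (Fin 3)} {i : Fin 3} {q : List (Fin 3)}
    (hp : IsPosition S p) (h : corner p i = Sum.inr q) : q ∈ S := by
  induction p generalizing i with
  | nil => simp [corner] at h
  | cons c p ih =>
    have hpS : p ∈ S := hp c p rfl
    revert h
    refine forall_fin_three (P := fun i => corner (c :: p) i = Sum.inr q → q ∈ S)
      (fun h => ?_) (fun h => ?_) (fun h => ?_) i
    · exact ih (hS.isPosition hpS) h
    · exact ih (hS.isPosition hpS) h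
    · cases h
      exact hpS

theorem corner_ne_self (p : List (Fin 3)) (i : Fin 3) : corner p i ≠ Sum.inr p :=
  fun h => lt_irrefl _ (corner_eq_inr h)

theorem corner_injective : ∀ p : List (Fin 3), Function.Injective (corner p)
  | [] => fun i j h => by simpa [corner] using h
  | c :: p => by
    have h01 : corner p c ≠ corner p (c + 1) := fun h => by
      exact absurd (corner_injective p h) ((by decide : ∀ c : Fin 3, c ≠ c + 1) c)
    have h0 := corner_ne_self p c
    have h1 := corner_ne_self p (c + 1)
    intro i j
    revert i
    refine forall_fin_three ?_ ?_ ?_ <;> revert j <;> refine forall_fin_three ?_ ?_ ?_ <;>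
      simp [h01, h0, h1, h01.symm, h0.symm, h1.symm]

/-- A face is determined by its corners. -/
theorem eq_of_corner {p q : List (Fin 3)} (h : ∀ j, ∃ j', corner p j = corner q j') : p = q := by
  choose φ hφ using h
  have hinj : Function.Injective φ := fun a b hab => corner_injective p (by rw [hφ, hφ, hab])
  have hsurj : Function.Surjective φ := Finite.surjective_of_injective hinj
  rcases p with _ | ⟨c, p⟩
  · rcases q with _ | ⟨c', q⟩
    · rfl
    · obtain ⟨j, hj⟩ := hsurj 2
      have := hφ j
      rw [hj] at this
      simp [corner] at this
  · have hp := hφ 2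
    rw [corner_cons_two] at hp
    have hlt := corner_eq_inr hp.symm
    rcases q with _ | ⟨c', q⟩
    · simp at hlt
    · obtain ⟨j, hj⟩ := hsurj 2
      have hq := hφ j
      rw [hj, corner_cons_two] at hq
      have hlt' := corner_eq_inr hq
      simp only [List.length_cons] at hlt hlt'
      -- The two inequalities make the tails `p` and `q` equally long, while the inserted corners in
      -- places 0 and 1 are strictly shorter: the newest corners must match.
      have hφ2 : φ 2 = 2 := by
        generalize φ 2 = k at hp
        revert hp
        revert k
        refine forall_fin_three (fun hp => ?_) (fun hp => ?_) (fun hp => rfl)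
        · rw [corner_cons_zero] at hp
          have := corner_eq_inr hp.symm
          omega
        · rw [corner_cons_one] at hp
          have := corner_eq_inr hp.symm
          omega
      rw [hφ2, corner_cons_two] at hp
      obtain rfl : p = q := by simpa using hp
      have h0 : ∀ x, (∃ j', corner p x = corner (c' :: p) j') → x = c' ∨ x = c' + 1 := by
        rintro x ⟨j', hj'⟩
        revert hj'
        revert j'
        refine forall_fin_three (fun h => ?_) (fun h => ?_) (fun h => ?_)
        · exact Or.inl (corner_injective p h)
        · exact Or.inr (corner_injective p h)
        · exact absurd h (corner_ne_self p x)
      have ha := h0 c ⟨_, hφ 0⟩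
      have hb := h0 (c + 1) ⟨_, hφ 1⟩
      -- A pair of cyclically consecutive elements of `Fin 3` determines its first element.
      rw [(by decide : ∀ c c' : Fin 3, (c = c' ∨ c = c' + 1) → (c + 1 = c' ∨ c + 1 = c' + 1) →
        c = c') c c' ha hb]

/-- The head of a word is the last choice of a face, so appending `c` puts one more insertion at the
beginning of the history. This is what allows recursion at the root of the tree. -/
theorem corner_append (p : List (Fin 3)) (c i : Fin 3) :
    corner (p ++ [c]) i =
      Sum.elim (corner [c]) (fun q => Sum.inr (q ++ [c])) (corner p i) := by
  induction p generalizing i with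
  | nil => simp [corner]
  | cons d p ih =>
    rw [List.cons_append]
    revert i
    refine forall_fin_three ?_ ?_ ?_
    · rw [corner_cons_zero, ih, corner_cons_zero]
    · rw [corner_cons_one, ih, corner_cons_one]
    · rfl

end StackCode

/-! ### Labellings of stack-triangulations -/

namespace RootedMap

open StackCode

variable {D D' : Type} {S S' : Finset (List (Fin 3))}

/-- `ℓ` identifies the darts of `M` with the labels of the darts of the map in which vertices have
been inserted in the faces that belong to `S`. -/
structure IsLabelling (S : Finset (List (Fin 3))) (M : RootedMap D) (ℓ : D → DartLabel) : Prop where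
  tree : IsTree S
  inj : Function.Injective ℓ
  mem_range : ∀ u, (∃ d, ℓ d = u) ↔ InDarts S u
  map_rev : ∀ d, ℓ (M.rev d) = reverse (ℓ d)
  map_root : ℓ M.root = (none, 0, true)
  map_face : ∀ p i d, IsLeaf S p → ℓ d = side p i → ℓ (M.face d) = side p (i + 1)
  map_face_outer : ∀ i d, ℓ d = (none, i, false) → ℓ (M.face d) = (none, i - 1, false)
  origin_of : ∀ d d', source (ℓ d) = source (ℓ d') → M.origin d = M.origin d'

theorem apply_inv_apply (σ : Perm D) (x : D) : σ (σ⁻¹ x) = x := Equiv.apply_symm_apply σ x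

theorem face_eq_iff (M : RootedMap D) {x y : D} : M.face x = y ↔ M.next y = M.rev x := by
  rw [face, Perm.mul_apply, Perm.inv_eq_iff_eq, eq_comm]

namespace IsLabelling

variable {M : RootedMap D} {N : RootedMap D'} {ℓ : D → DartLabel} {ℓ' : D' → DartLabel}

theorem inDarts (h : IsLabelling S M ℓ) (d : D) : InDarts S (ℓ d) := (h.mem_range _).1 ⟨d, rfl⟩

theorem cover (h : IsLabelling S M ℓ) (d : D) :
    (∃ i, ℓ d = (none, i, false)) ∨ ∃ p i, IsLeaf S p ∧ ℓ d = side p i := (h.inDarts d).cover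

/-- The dart `M.next d` is the reverse of the dart whose face successor is `d`, so the rotation can
be read off the labels of reversals and faces. -/
theorem source_next (h : IsLabelling S M ℓ) (d : D) : source (ℓ (M.next d)) = source (ℓ d) := by
  obtain ⟨e, he⟩ : ∃ e, M.next d = M.rev e := ⟨M.rev (M.next d), (M.rev_rev _).symm⟩
  rw [he, h.map_rev]
  obtain rfl := M.face_eq_iff.2 he
  rcases h.cover e with ⟨i, hi⟩ | ⟨p, i, hp, hi⟩
  · rw [h.map_face_outer i e hi, hi]
    simp [reverse, source]
  · rw [h.map_face p i e hp hi, hi, source_reverse_side, source_side]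

/-- Two darts have the same origin if and only if their labels have the same origin. -/
theorem origin_iff (h : IsLabelling S M ℓ) {d d' : D} :
    M.origin d = M.origin d' ↔ source (ℓ d) = source (ℓ d') := by
  refine ⟨fun hd => ?_, h.origin_of d d'⟩
  obtain ⟨z, rfl⟩ := origin_eq.1 hd
  symm
  induction z using Int.induction_on with
  | zero => rfl
  | succ n ih => rw [add_comm, zpow_add, zpow_one, Perm.mul_apply, h.source_next,
      ih (origin_eq.2 ⟨n, rfl⟩)]
  | pred n ih =>
    rw [← h.source_next, sub_eq_add_neg, add_comm, zpow_add, zpow_neg_one, Perm.mul_apply,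
      apply_inv_apply, ih (origin_eq.2 ⟨_, rfl⟩)]

theorem infinite_iff (h : IsLabelling S M ℓ) {d : D} :
    M.InInfiniteFace d ↔ ∃ i, ℓ d = (none, i, false) := by
  have h0 : ℓ (M.rev M.root) = (none, 0, false) := by rw [h.map_rev, h.map_root]; rfl
  have h2 := h.map_face_outer _ _ h0
  have h1 := h.map_face_outer _ _ h2
  constructor
  · rintro ⟨z, rfl⟩
    induction z using Int.induction_on with
    | zero => exact ⟨0, h0⟩
    | succ n ih =>
      obtain ⟨i, hi⟩ := ih
      exact ⟨i - 1, by rw [add_comm, zpow_add, zpow_one, Perm.mul_apply, h.map_face_outer _ _ hi]⟩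
    | pred n ih =>
      obtain ⟨i, hi⟩ := ih
      rw [sub_eq_add_neg, add_comm, zpow_add, zpow_neg_one, Perm.mul_apply]
      generalize (M.face ^ (-(n : ℤ))) (M.rev M.root) = x at hi
      -- A predecessor on the boundary of a leaf would have its successor there too, but outer darts
      -- are never sides.
      rcases h.cover (M.face⁻¹ x) with hx | ⟨p, j, hp, hx⟩
      · exact hx
      · have := h.map_face p j _ hp hx
        rw [apply_inv_apply, hi] at this
        exact absurd this.symm (side_ne_outer _ _ _)
  · rintro ⟨i, hi⟩
    have key : ∀ (n : ℕ) (x : D), ℓ d = ℓ x → x = (M.face ^ n) (M.rev M.root) →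
        M.InInfiniteFace d := by
      rintro n x hx rfl
      rw [h.inj hx]
      exact ⟨n, by simp⟩
    revert hi
    revert i
    refine forall_fin_three (fun hi => ?_) (fun hi => ?_) (fun hi => ?_)
    · exact key 0 _ (hi.trans h0.symm) rfl
    · exact key 2 _ (hi.trans h1.symm) (by simp [pow_succ])
    · exact key 1 _ (hi.trans h2.symm) (by simp)

theorem exists_leaf (h : IsLabelling S M ℓ) {d : D} (hd : ¬ M.InInfiniteFace d) :
    ∃ p i, IsLeaf S p ∧ ℓ d = side p i :=
  (h.cover d).resolve_left fun hi => hd (h.infinite_iff.2 hi)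

theorem of_iso (h : IsLabelling S M ℓ) (e : Iso M N) : IsLabelling S N (ℓ ∘ e.toEquiv.symm) where
  tree := h.tree
  inj := h.inj.comp e.toEquiv.symm.injective
  mem_range u := by
    rw [← h.mem_range]
    exact e.toEquiv.symm.surjective.exists (p := fun d => ℓ d = u).symm
  map_rev d := by
    rw [Function.comp, Function.comp, ← h.map_rev]
    exact congrArg ℓ (e.symm.map_rev d)
  map_root := (congrArg ℓ e.symm.map_root).trans h.map_root
  map_face p i d hp hd := (congrArg ℓ (e.symm.map_face d)).trans (h.map_face p i _ hp hd)
  map_face_outer i d hd := (congrArg ℓ (e.symm.map_face d)).trans (h.map_face_outer i _ hd)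
  origin_of d d' hd := by
    have := origin_eq.1 (h.origin_of _ _ hd)
    rw [← Iso.sameCycle e.toEquiv e.map_next] at this
    simpa [origin_eq] using this

/-- Maps with the same set of labels are isomorphic. -/
theorem nonempty_iso (h : IsLabelling S M ℓ) (h' : IsLabelling S N ℓ') : Nonempty (Iso M N) := by
  have hex : ∀ d, ∃ d', ℓ' d' = ℓ d := fun d => (h'.mem_range _).2 (h.inDarts d)
  choose φ hφ using hex
  have hbij : Function.Bijective φ := by
    constructor
    · intro a b hab
      exact h.inj (by rw [← hφ, ← hφ, hab])
    · intro d'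
      obtain ⟨d, hd⟩ := (h.mem_range _).2 (h'.inDarts d')
      exact ⟨d, h'.inj (by rw [hφ, hd])⟩
  have hrev : ∀ d, φ (M.rev d) = N.rev (φ d) := fun d => h'.inj (by
    rw [hφ, h.map_rev, h'.map_rev, hφ])
  have hface : ∀ d, φ (M.face d) = N.face (φ d) := fun d => h'.inj (by
    rw [hφ]
    rcases h.cover d with ⟨i, hi⟩ | ⟨p, i, hp, hi⟩
    · rw [h.map_face_outer i d hi, h'.map_face_outer i _ ((hφ d).trans hi)]
    · rw [h.map_face p i d hp hi, h'.map_face p i _ hp ((hφ d).trans hi)])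
  refine ⟨⟨Equiv.ofBijective φ hbij, fun d => ?_, hrev, h'.inj ?_⟩⟩
  -- The labels control `rev` and `face` only; these two determine `next`.
  · have := (M.face_eq_iff (x := M.rev (M.next d)) (y := d)).2 (M.rev_rev _).symm
    have h2 := hface (M.rev (M.next d))
    rw [this, hrev, eq_comm, N.face_eq_iff, N.rev_rev] at h2
    exact h2.symm
  · rw [h'.map_root]
    exact (hφ _).trans h.map_root

theorem triangle : IsLabelling ∅ triangle (fun d => (none, d)) where
  tree _ _ h := absurd h (Finset.notMem_empty _)
  inj _ _ h := by simpa using h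
  mem_range := by
    rintro ⟨_ | p, d⟩
    · simp [InDarts]
    · simp [InDarts]
  map_rev d := rfl
  map_root := rfl
  map_face p i d hp hd := by
    obtain rfl : p = [] := by
      rcases p with _ | ⟨c, p⟩
      · rfl
      · exact absurd (hp.2 c p rfl) (Finset.notMem_empty _)
    obtain ⟨-, rfl⟩ := Prod.mk.inj hd
    have : ∀ i, RootedMap.triangle.face (i, true) = (i + 1, true) := by decide
    rw [this]
    rfl
  map_face_outer i d hd := by
    obtain ⟨-, rfl⟩ := Prod.mk.inj hd
    have : ∀ i, RootedMap.triangle.face (i, false) = (i - 1, false) := by decide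
    rw [this]
  origin_of d d' h := by
    rw [origin_eq]
    have : ∀ d d' : Fin 3 × Bool, source (none, d) = source (none, d') →
        d = d' ∨ RootedMap.triangle.next d = d' := by
      have hs : ∀ d : Fin 3 × Bool, source (none, d) = Sum.inl (if d.2 then d.1 else d.1 + 1) := by
        rintro ⟨i, _ | _⟩ <;> rfl
      intro d d'
      rw [hs, hs, Sum.inl.injEq]
      revert d d'
      decide
    rcases this d d' h with rfl | rfl
    · exact Perm.SameCycle.refl _ _
    · exact ⟨1, by simp⟩

/-! Effect of an insertion. -/

/-- The labels after an insertion in the face `p`, at the dart `side p i`. -/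
def insertLabel (ℓ : D → DartLabel) (p : List (Fin 3)) (i : Fin 3) :
    D ⊕ Fin 3 × Bool → DartLabel
  | Sum.inl d => ℓ d
  | Sum.inr (j, b) => (some p, j + i, b)

end IsLabelling

/-- The three boundary darts of a triangular face. -/
def boundary (M : RootedMap D) (f : D) : Fin 3 → D := ![f, M.face f, M.face (M.face f)]

theorem insert_next_boundary (M : RootedMap D) {f : D} (h : Function.Injective (M.boundary f))
    (j : Fin 3) :
    (M.insertVertex f).next (Sum.inl (M.boundary f j)) = Sum.inr (j, false) ∧
    (M.insertVertex f).next (Sum.inr (j, false)) = Sum.inl (M.next (M.boundary f j)) := by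
  have h01 : f ≠ M.face f := fun e => by simpa using @h 0 1 e
  have h02 : f ≠ M.face (M.face f) := fun e => by simpa using @h 0 2 e
  have h12 : M.face f ≠ M.face (M.face f) := fun e => by simpa using @h 1 2 e
  have hl : ∀ (d : D) (i : Fin 3), exch d i (Sum.inl d) = Sum.inr (i, false) := fun d i => by
    simp [exch]
  have hr : ∀ (d : D) (i : Fin 3), exch d i (Sum.inr (i, false)) = Sum.inl d := fun d i => by
    simp [exch]
  have el : ∀ (d d' : D) (i : Fin 3), d' ≠ d → exch d i (Sum.inl d') = Sum.inl d' :=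
    fun d d' i hd => exch_of_ne (by simpa using hd) (by simp)
  have er : ∀ (d : D) (i j : Fin 3), j ≠ i → exch d i (Sum.inr (j, false)) = Sum.inr (j, false) :=
    fun d i j hj => exch_of_ne (by simp) (by simpa using hj)
  revert j
  refine StackCode.forall_fin_three ⟨?_, ?_⟩ ⟨?_, ?_⟩ ⟨?_, ?_⟩
  · change sumCongr M.next spin (exch f 0 (exch _ 1 (exch _ 2 (Sum.inl f)))) = _
    rw [el _ _ _ h02, el _ _ _ h01, hl]
    rfl
  · change sumCongr M.next spin (exch f 0 (exch _ 1 (exch _ 2 _))) = Sum.inl (M.next f)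
    rw [er _ _ _ (by decide), er _ _ _ (by decide), hr]
    rfl
  · change sumCongr M.next spin (exch f 0 (exch _ 1 (exch _ 2 (Sum.inl (M.face f))))) = _
    rw [el _ _ _ h12, hl, er _ _ _ (by decide)]
    rfl
  · change sumCongr M.next spin (exch f 0 (exch _ 1 (exch _ 2 _))) = Sum.inl (M.next (M.face f))
    rw [er _ _ _ (by decide), hr, el _ _ _ h01.symm]
    rfl
  · change sumCongr M.next spin (exch f 0 (exch _ 1 (exch _ 2 (Sum.inl (M.face (M.face f)))))) = _
    rw [hl, er _ _ _ (by decide), er _ _ _ (by decide)]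
    rfl
  · change sumCongr M.next spin (exch f 0 (exch _ 1 (exch _ 2 _))) =
      Sum.inl (M.next (M.face (M.face f)))
    rw [hr, el _ _ _ h12.symm, el _ _ _ h02.symm]
    rfl

theorem insert_next_of_forall_ne (M : RootedMap D) {f d : D} (h : ∀ j, d ≠ M.boundary f j) :
    (M.insertVertex f).next (Sum.inl d) = Sum.inl (M.next d) :=
  M.insert_next_inl (h 0) (h 1) (h 2)

/-- An insertion only interposes a new dart after each boundary dart, so one step of the old
rotation is one or two steps of the new one. -/
theorem insert_sameCycle (M : RootedMap D) {f : D} (h : Function.Injective (M.boundary f))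
    {d d' : D} (hd : M.next.SameCycle d d') :
    (M.insertVertex f).next.SameCycle (Sum.inl d) (Sum.inl d') := by
  have step : ∀ d, (M.insertVertex f).next.SameCycle (Sum.inl d) (Sum.inl (M.next d)) := by
    intro d
    by_cases hb : ∃ j, d = M.boundary f j
    · obtain ⟨j, rfl⟩ := hb
      refine ⟨2, ?_⟩
      rw [zpow_ofNat, pow_two, Perm.mul_apply, (M.insert_next_boundary h j).1,
        (M.insert_next_boundary h j).2]
    · push Not at hb
      exact ⟨1, by rw [zpow_one, M.insert_next_of_forall_ne hb]⟩
  obtain ⟨z, rfl⟩ := hd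
  induction z using Int.induction_on with
  | zero => exact Perm.SameCycle.refl _ _
  | succ n ih =>
    rw [add_comm, zpow_add, zpow_one, Perm.mul_apply]
    exact ih.trans (step _)
  | pred n ih =>
    rw [sub_eq_add_neg, add_comm, zpow_add, zpow_neg_one, Perm.mul_apply]
    refine ih.trans ?_
    have := (step (M.next⁻¹ ((M.next ^ (-(n : ℤ))) d))).symm
    rwa [apply_inv_apply] at this

namespace IsLabelling

variable {M : RootedMap D} {ℓ : D → DartLabel}

theorem label_boundary (h : IsLabelling S M ℓ) {p : List (Fin 3)} {i : Fin 3} {f : D}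
    (hp : IsLeaf S p) (hf : ℓ f = side p i) (j : Fin 3) :
    ℓ (M.boundary f j) = side p (j + i) := by
  have h1 := h.map_face p i f hp hf
  have h2 := h.map_face p _ _ hp h1
  revert j
  refine forall_fin_three ?_ ?_ ?_
  · simpa [boundary] using hf
  · rw [add_comm]
    exact h1
  · exact h2.trans (congrArg _ ((by decide : ∀ i : Fin 3, i + 1 + 1 = 2 + i) i))

theorem boundary_injective (h : IsLabelling S M ℓ) {p : List (Fin 3)} {i : Fin 3} {f : D}
    (hp : IsLeaf S p) (hf : ℓ f = side p i) : Function.Injective (M.boundary f) := by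
  intro a b hab
  have := congrArg ℓ hab
  rw [h.label_boundary hp hf, h.label_boundary hp hf] at this
  simpa using (hp.side_inj h.tree hp this).2

/-- Faces other than `p` keep their sides, and `p` is replaced by the three cycles `boundary j`, `(j
+ 1, false)`, `(j, true)`, which are the sides of `(j + i) :: p`. The shift by `i` appears because
`insertVertex` numbers the corners from `f`, which is side `i` of `p`. -/
theorem insert (h : IsLabelling S M ℓ) {p : List (Fin 3)} {i : Fin 3} {f : D}
    (hp : IsLeaf S p) (hf : ℓ f = side p i) :
    IsLabelling (insert p S) (M.insertVertex f) (insertLabel ℓ p i) := by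
  classical
  have hinj := h.boundary_injective hp hf
  have hb := h.label_boundary hp hf
  have hnew : ∀ d, source (ℓ d) ≠ Sum.inr p := by
    intro d hd
    have hD := h.inDarts d
    revert hd hD
    rcases ℓ d with ⟨_ | q, j, _ | _⟩
    · simp [source]
    · simp [source]
    · intro hd hD
      exact hp.1 (corner_mem h.tree (h.tree.isPosition (hD q rfl)) hd)
    · intro hd hD
      simp only [source, Sum.inr.injEq] at hd
      exact hp.1 (hd ▸ hD q rfl)
  have hold : ∀ d, (ℓ d).1 ≠ some p := fun d hd => hp.1 (h.inDarts d p hd)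
  have htree : IsTree (Insert.insert p S) := by
    intro c q hq
    rcases Finset.mem_insert.1 hq with hq | hq
    · exact Finset.mem_insert_of_mem (hp.2 c q hq.symm)
    · exact Finset.mem_insert_of_mem (h.tree c q hq)
  have hinj' : Function.Injective (insertLabel ℓ p i) := by
    rintro (d | ⟨j, b⟩) (d' | ⟨j', b'⟩) hd
    · exact congrArg _ (h.inj hd)
    · exact absurd (congrArg Prod.fst hd) (hold d)
    · exact absurd (congrArg Prod.fst hd).symm (hold d')
    · simpa [insertLabel] using hd
  -- the faces of the new map
  have face_old : ∀ d, (∀ j, M.face d ≠ M.boundary f j) →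
      (M.insertVertex f).face (Sum.inl d) = Sum.inl (M.face d) := by
    intro d hd'
    rw [face_eq_iff, M.insert_next_of_forall_ne hd', M.face_eq_iff.1 rfl]
    rfl
  have hfb : ∀ j, M.face (M.boundary f j) = M.boundary f (j + 1) := fun j => h.inj (by
    rw [h.map_face p _ _ hp (hb j), hb, add_right_comm])
  have face0 : ∀ j, (M.insertVertex f).face (Sum.inl (M.boundary f j)) =
      Sum.inr (j + 1, false) := by
    intro j
    rw [face_eq_iff, (M.insert_next_boundary hinj _).2, M.face_eq_iff.1 (hfb j)]
    rfl
  have face1 : ∀ j, (M.insertVertex f).face (Sum.inr (j + 1, false)) = Sum.inr (j, true) := by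
    intro j
    rw [face_eq_iff, insert_next_new]
    rfl
  have face2 : ∀ j, (M.insertVertex f).face (Sum.inr (j, true)) =
      Sum.inl (M.boundary f j) := by
    intro j
    rw [face_eq_iff, (M.insert_next_boundary hinj _).1]
    rfl
  have hface_ne : ∀ d, (∀ j, d ≠ M.boundary f j) → ∀ j, M.face d ≠ M.boundary f j := by
    intro d hd j hj
    refine hd (j - 1) (M.face.injective ?_)
    rw [hj, hfb, sub_add_cancel]
  refine ⟨htree, hinj', ?_, ?_, h.map_root, ?_, ?_, ?_⟩
  · intro u
    constructor
    · rintro ⟨d | ⟨j, b⟩, rfl⟩ q hq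
      · exact Finset.mem_insert_of_mem (h.inDarts d q hq)
      · obtain rfl : p = q := by simpa [insertLabel] using hq
        exact Finset.mem_insert_self _ _
    · intro hu
      by_cases hup : u.1 = some p
      · obtain ⟨_, j, b⟩ := u
        obtain rfl := hup
        exact ⟨Sum.inr (j - i, b), by simp [insertLabel]⟩
      · obtain ⟨d, hd⟩ := (h.mem_range u).2 fun q hq =>
          Finset.mem_of_mem_insert_of_ne (hu q hq) (by rintro rfl; exact hup hq)
        exact ⟨Sum.inl d, hd⟩
  · rintro (d | ⟨j, b⟩)
    · exact h.map_rev d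
    · rfl
  · intro q j x hq hx
    by_cases hqS : IsPosition S q
    · -- an old face
      have hqp : p ≠ q := fun e => hq.1 (e ▸ Finset.mem_insert_self _ _)
      have hqL : IsLeaf S q := ⟨fun hm => hq.1 (Finset.mem_insert_of_mem hm), hqS⟩
      obtain ⟨d, hd⟩ := (h.mem_range (side q j)).2 (side_inDarts h.tree q hqS j)
      obtain rfl : x = Sum.inl d := hinj' (by rw [hx]; exact hd.symm)
      have hne : ∀ j', d ≠ M.boundary f j' := by
        rintro j' rfl
        rw [hb] at hd
        exact hqp (hp.side_inj h.tree hqL hd).1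
      rw [face_old d (hface_ne d hne)]
      exact h.map_face q j d hqL hd
    · -- one of the three new faces
      obtain ⟨c, rfl⟩ : ∃ c, q = c :: p := by
        unfold IsPosition at hqS
        push Not at hqS
        obtain ⟨c, q', rfl, hq'⟩ := hqS
        have := (Finset.mem_insert.1 (hq.2 c q' rfl)).resolve_right hq'
        exact ⟨c, by rw [this]⟩
      obtain ⟨a, rfl⟩ : ∃ a, c = a + i := ⟨c - i, by simp⟩
      revert hx
      revert j
      refine forall_fin_three (fun hx => ?_) (fun hx => ?_) (fun hx => ?_)
      · obtain rfl : x = Sum.inl (M.boundary f a) := hinj' (by rw [hx]; exact (hb a).symm)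
        rw [face0]
        simp [insertLabel, add_right_comm]
      · obtain rfl : x = Sum.inr (a + 1, false) := hinj' (by
          rw [hx]
          simp [insertLabel, add_right_comm])
        rw [face1]
        simp [insertLabel]
      · obtain rfl : x = Sum.inr (a, true) := hinj' (by rw [hx]; rfl)
        rw [face2]
        exact hb a
  · rintro j (d | ⟨j', b⟩) hd
    · have hne : ∀ j', d ≠ M.boundary f j' := by
        rintro j' rfl
        exact side_ne_outer _ _ _ ((hb j').symm.trans hd)
      rw [face_old d (hface_ne d hne)]
      exact h.map_face_outer j d hd
    · simp [insertLabel] at hd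
  · have hold_origin : ∀ d d', source (ℓ d) = source (ℓ d') →
        (M.insertVertex f).origin (Sum.inl d) = (M.insertVertex f).origin (Sum.inl d') :=
      fun d d' hd => origin_eq.2 (M.insert_sameCycle hinj (origin_eq.1 (h.origin_of d d' hd)))
    have hto_new : ∀ j, (M.insertVertex f).origin (Sum.inr (j, false)) =
        (M.insertVertex f).origin (Sum.inl (M.boundary f j)) := by
      intro j
      refine (origin_eq.2 ⟨1, ?_⟩).symm
      rw [zpow_one, (M.insert_next_boundary hinj j).1]
    have hsource : ∀ j, source (insertLabel ℓ p i (Sum.inr (j, false))) =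
        source (ℓ (M.boundary f j)) := by
      intro j
      rw [hb, source_side]
      rfl
    have hfrom_new : ∀ j, (M.insertVertex f).origin (Sum.inr (j, true)) =
        (M.insertVertex f).origin (Sum.inr (0, true)) := by
      have hstep : ∀ j, (M.insertVertex f).origin (Sum.inr (j, true)) =
          (M.insertVertex f).origin (Sum.inr (j + 1, true)) := fun j =>
        origin_eq.2 ⟨1, by rw [zpow_one, insert_next_new]⟩
      exact forall_fin_three rfl (hstep 0).symm (hstep 2)
    -- every dart has the origin and the label of an old dart, or comes from the new vertex
    have hred : ∀ x, (∃ j, x = Sum.inr (j, true)) ∨ ∃ d,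
        (M.insertVertex f).origin x = (M.insertVertex f).origin (Sum.inl d) ∧
        source (insertLabel ℓ p i x) = source (ℓ d) := by
      rintro (d | ⟨j, _ | _⟩)
      · exact Or.inr ⟨d, rfl, rfl⟩
      · exact Or.inr ⟨_, hto_new j, hsource j⟩
      · exact Or.inl ⟨j, rfl⟩
    intro x y hxy
    rcases hred x with ⟨j, rfl⟩ | ⟨d, hx, hx'⟩ <;> rcases hred y with ⟨j', rfl⟩ | ⟨d', hy, hy'⟩
    · rw [hfrom_new, hfrom_new j']
    · exact absurd (hy'.symm.trans hxy.symm) (hnew d')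
    · exact absurd (hx'.symm.trans hxy) (hnew d)
    · rw [hx, hy]
      exact hold_origin d d' (by rw [← hx', ← hy', hxy])

end IsLabelling

end RootedMap

/-! ### Degrees read off the labels, and uniqueness of the tree -/

namespace StackCode

theorem source_mem {S : Finset (List (Fin 3))} (hS : IsTree S) {u : DartLabel} (hu : InDarts S u)
    {q : List (Fin 3)} (h : source u = Sum.inr q) : q ∈ S := by
  revert hu h
  rcases u with ⟨_ | p, i, _ | _⟩
  · simp [source]
  · simp [source]
  · intro hu h
    exact corner_mem hS (hS.isPosition (hu p rfl)) h
  · intro hu h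
    obtain rfl : p = q := by simpa [source] using h
    exact hu p rfl

theorem inDarts_some {S : Finset (List (Fin 3))} {p : List (Fin 3)} (hp : p ∈ S)
    (x : Fin 3 × Bool) : InDarts S (some p, x) := by
  intro q hq
  obtain rfl : p = q := by simpa using hq
  exact hp

/-- The number of insertions in `S` that increase the degree of the vertex `v`. -/
def cornerCount (S : Finset (List (Fin 3))) (v : VertexLabel) : ℕ :=
  ((S ×ˢ (Finset.univ : Finset (Fin 3))).filter fun x => corner x.1 x.2 = v).card

/-- Three darts leave the vertex at its own insertion, and each insertion in a face `p` with corner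
`i` at this vertex adds the dart `(some p, i, false)`. -/
theorem ncard_source {S : Finset (List (Fin 3))} {q : List (Fin 3)} (hq : q ∈ S) :
    {u | InDarts S u ∧ source u = Sum.inr q}.ncard = 3 + cornerCount S (Sum.inr q) := by
  classical
  have h : {u | InDarts S u ∧ source u = Sum.inr q} =
      ((Finset.univ.image fun i : Fin 3 => ((some q, i, true) : DartLabel)) ∪
        ((S ×ˢ Finset.univ).filter fun x => corner x.1 x.2 = Sum.inr q).image
          fun x => ((some x.1, x.2, false) : DartLabel) : Finset DartLabel) := by
    ext ⟨_ | p, i, _ | _⟩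
    · simp [source]
    · simp [source]
    · simp [source, InDarts]
    · simp only [source, InDarts, Option.some.injEq, forall_eq', Set.mem_ofPred_eq, Sum.inr.injEq,
        Finset.coe_union, Finset.coe_image, Set.mem_union, Set.mem_image, Finset.mem_coe,
        Finset.mem_univ, true_and, Prod.mk.injEq, and_true, Bool.false_eq_true, and_false,
        exists_false, or_false, exists_eq_right]
      exact ⟨fun h => h.2.symm, fun h => ⟨h ▸ hq, h.symm⟩⟩
  rw [h, Set.ncard_coe_finset, Finset.card_union_of_disjoint, Finset.card_image_of_injective,
    Finset.card_image_of_injective]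
  · simp [cornerCount]
  · rintro ⟨p, i⟩ ⟨p', i'⟩ h
    simpa using h
  · intro i i' h
    simpa using h
  · rw [Finset.disjoint_left]
    intro u hu hu'
    obtain ⟨i, -, rfl⟩ := Finset.mem_image.1 hu
    obtain ⟨x, -, hx⟩ := Finset.mem_image.1 hu'
    simp at hx

end StackCode

namespace RootedMap

open StackCode

variable {D D' : Type} {S S' : Finset (List (Fin 3))}

namespace IsLabelling

variable {M : RootedMap D} {N : RootedMap D'} {ℓ ℓ' : D → DartLabel}

theorem exists_dart (h : IsLabelling S M ℓ) {p : List (Fin 3)} (hp : p ∈ S) (x : Fin 3 × Bool) :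
    ∃ d, ℓ d = (some p, x) := (h.mem_range _).2 (inDarts_some hp x)

/-! ### The labelling of the vertices is unique -/

theorem source_outer (h : IsLabelling S M ℓ) (i : Fin 3) :
    source (ℓ (![M.root, M.rev M.root, M.face (M.face (M.rev M.root))] i)) = Sum.inl i := by
  have h0 : ℓ (M.rev M.root) = (none, 0, false) := by rw [h.map_rev, h.map_root]; rfl
  have h2 := h.map_face_outer _ _ (h.map_face_outer _ _ h0)
  revert i
  refine forall_fin_three ?_ ?_ ?_
  · exact (congrArg source h.map_root).trans rfl
  · exact (congrArg source h0).trans rfl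
  · exact (congrArg source h2).trans rfl

theorem source_outer_iff (h : IsLabelling S M ℓ) (h' : IsLabelling S' M ℓ') {d : D} {i : Fin 3} :
    source (ℓ d) = Sum.inl i ↔ source (ℓ' d) = Sum.inl i := by
  rw [← h.source_outer i, ← h.origin_iff, h'.origin_iff, h'.source_outer i, h.source_outer i]

/-- The vertex `p` is adjacent to the corners of the face `p`, which are outer or older and hence
carry the same name in both labellings by induction. If `ℓ'` calls the vertex `q`, these neighbours
are corners of the face `q`, and `eq_of_corner` applies. -/
theorem source_inner (h : IsLabelling S M ℓ) (h' : IsLabelling S' M ℓ') (n : ℕ) :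
    ∀ p ∈ S, p.length < n → ∀ d, source (ℓ d) = Sum.inr p → source (ℓ' d) = Sum.inr p := by
  induction n with
  | zero => intro p _ h; omega
  | succ n ih =>
    intro p hp hn d hd
    have hrev : ∀ j : Fin 3, ∃ g, M.origin g = M.origin d ∧
        source (ℓ' (M.rev g)) = corner p j := by
      intro j
      obtain ⟨g, hg⟩ := h.exists_dart hp (j, true)
      refine ⟨g, h.origin_iff.2 (by rw [hg, hd]; rfl), ?_⟩
      have hs : source (ℓ (M.rev g)) = corner p j := by
        rw [h.map_rev, hg]
        rfl
      cases hc : corner p j with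
      | inl i => rw [← source_outer_iff h h', hs, hc]
      | inr r =>
        have hlt := corner_eq_inr hc
        exact ih r (corner_mem h.tree (h.tree.isPosition hp) hc) (by omega) _ (hs.trans hc)
    cases hq : source (ℓ' d) with
    | inl i =>
      rw [← source_outer_iff h h', hd] at hq
      cases hq
    | inr q =>
      rw [eq_of_corner (p := p) (q := q)]
      intro j
      obtain ⟨g, hg, hj⟩ := hrev j
      rw [h'.origin_iff, hq] at hg
      rw [h'.map_rev] at hj
      rcases hu : ℓ' g with ⟨_ | r, j', _ | _⟩ <;> rw [hu] at hg hj
      · cases hg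
      · cases hg
      -- Here `ℓ'` takes the neighbour `r` for a vertex inserted after `q`. Then `q` is older than
      -- `r`, which is older than `p`; by induction the vertex named `q` by `ℓ` is also named `q` by
      -- `ℓ'`, so it coincides with the vertex `p`, against the lengths.
      · exfalso
        have hr : corner p j = Sum.inr r := hj.symm
        have hlt := corner_eq_inr hr
        have hlt' := corner_eq_inr (show corner r j' = Sum.inr q from hg)
        have hrS := corner_mem h.tree (h.tree.isPosition hp) hr
        have hqS := corner_mem h.tree (h.tree.isPosition hrS)
          (show corner r j' = Sum.inr q from hg)
        obtain ⟨e, he⟩ := h.exists_dart hqS (0, true)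
        have he' : source (ℓ e) = Sum.inr q := by rw [he]; rfl
        have := ih q hqS (by omega) e he'
        rw [← hq, ← h'.origin_iff, h.origin_iff, he', hd] at this
        cases this
        omega
      · obtain rfl : r = q := by simpa [source] using hg
        exact ⟨j', hj.symm⟩

theorem subset (h : IsLabelling S M ℓ) (h' : IsLabelling S' M ℓ') : S ⊆ S' := by
  intro p hp
  obtain ⟨d, hd⟩ := h.exists_dart hp (0, true)
  exact source_mem h'.tree (h'.inDarts d)
    (source_inner h h' _ p hp (Nat.lt_succ_self _) d (by rw [hd]; rfl))

theorem tree_unique (h : IsLabelling S M ℓ) (h' : IsLabelling S' M ℓ') : S = S' :=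
  (h.subset h').antisymm (h'.subset h)

/-! ### Degrees, internal vertices -/

theorem degree_eq (h : IsLabelling S M ℓ) {d : D} {q : List (Fin 3)}
    (hd : source (ℓ d) = Sum.inr q) :
    M.degree (M.origin d) = 3 + cornerCount S (Sum.inr q) := by
  rw [← ncard_source (source_mem h.tree (h.inDarts d) hd), degree,
    ← Set.ncard_image_of_injective _ h.inj]
  congr 1
  ext u
  constructor
  · rintro ⟨e, he, rfl⟩
    exact ⟨h.inDarts e, (h.origin_iff.1 he).trans hd⟩
  · rintro ⟨hu, hs⟩
    obtain ⟨e, rfl⟩ := (h.mem_range u).2 hu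
    exact ⟨e, h.origin_iff.2 (hs.trans hd.symm), rfl⟩

theorem isInternal_iff (h : IsLabelling S M ℓ) {d : D} :
    M.IsInternal (M.origin d) ↔ ∃ q, source (ℓ d) = Sum.inr q := by
  constructor
  · intro hd
    cases hs : source (ℓ d) with
    | inr q => exact ⟨q, rfl⟩
    | inl i =>
      obtain ⟨e, he⟩ := (h.mem_range (none, i - 1, false)).2 (by intro p hp; cases hp)
      refine absurd (h.infinite_iff.2 ⟨_, he⟩) (hd e (h.origin_iff.2 ?_))
      rw [he, hs]
      simp [source]
  · rintro ⟨q, hq⟩ e he hinf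
    obtain ⟨i, hi⟩ := h.infinite_iff.1 hinf
    rw [h.origin_iff, hi, hq] at he
    cases he

end IsLabelling

/-! ### Stack-triangulations and trees -/

theorem IsStack.exists_isLabelling {k : ℕ} {M : RootedMap D} (h : IsStack k M) :
    ∃ S ℓ, IsLabelling S M ℓ ∧ S.card + 1 = k := by
  induction h with
  | base => exact ⟨_, _, IsLabelling.triangle, rfl⟩
  | step f _ hf ih =>
    obtain ⟨S, ℓ, h, rfl⟩ := ih
    obtain ⟨p, i, hp, hi⟩ := h.exists_leaf hf
    exact ⟨_, _, h.insert hp hi, by rw [Finset.card_insert_of_notMem hp.1]⟩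
  | iso e _ ih =>
    obtain ⟨S, ℓ, h, hk⟩ := ih
    exact ⟨_, _, h.of_iso e, hk⟩

/-- A longest node has no child in `S`; without it the set is still a tree, of which this node is a
leaf, so it can be inserted last. -/
theorem exists_map_of_isTree (n : ℕ) : ∀ S : Finset (List (Fin 3)), IsTree S → S.card = n →
    ∃ (M : RootedMap (Fin (6 * (n + 1)))) (ℓ : _), IsStack (n + 1) M ∧ IsLabelling S M ℓ := by
  induction n with
  | zero =>
    intro S _ hS
    obtain rfl := Finset.card_eq_zero.1 hS
    have e : Fin 3 × Bool ≃ Fin (6 * (0 + 1)) := Fintype.equivFinOfCardEq (by simp)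
    exact ⟨_, _, IsStack.iso (triangle.relabelIso e) IsStack.base,
      IsLabelling.triangle.of_iso (triangle.relabelIso e)⟩
  | succ n ih =>
    intro S hS hn
    obtain ⟨p, hp, hmax⟩ := S.exists_max_image List.length (Finset.card_pos.1 (by omega))
    have hS' : IsTree (S.erase p) := by
      intro c q hq
      have hq' := Finset.mem_of_mem_erase hq
      refine Finset.mem_erase.2 ⟨?_, hS c q hq'⟩
      rintro rfl
      have := hmax _ hq'
      simp at this
    have hleaf : IsLeaf (S.erase p) p := by
      refine ⟨Finset.notMem_erase p S, ?_⟩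
      rintro c q rfl
      exact Finset.mem_erase.2 ⟨(List.cons_ne_self c q).symm, hS c q hp⟩
    obtain ⟨M, ℓ, hM, h⟩ := ih _ hS' (by rw [Finset.card_erase_of_mem hp, hn]; rfl)
    obtain ⟨f, hf⟩ := (h.mem_range _).2 (side_inDarts hS' p hleaf.2 0)
    have hinf : ¬ M.InInfiniteFace f := by
      intro hinf
      obtain ⟨i, hi⟩ := h.infinite_iff.1 hinf
      exact side_ne_outer p 0 i (hf.symm.trans hi)
    have e : Fin (6 * (n + 1)) ⊕ Fin 3 × Bool ≃ Fin (6 * (n + 1 + 1)) :=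
      Fintype.equivFinOfCardEq (by simp; ring)
    have hins := (h.insert hleaf hf).of_iso ((M.insertVertex f).relabelIso e)
    rw [Finset.insert_erase hp] at hins
    exact ⟨_, _, IsStack.iso ((M.insertVertex f).relabelIso e) (IsStack.step f hM hinf), hins⟩

theorem IsFirstInserted.exists_isLabelling {M : RootedMap D} {v : M.Vertex}
    (h : IsFirstInserted M v) :
    ∃ S ℓ, IsLabelling S M ℓ ∧ ∃ d, M.origin d = v ∧ source (ℓ d) = Sum.inr [] := by
  induction h with
  | base f hf =>
    obtain ⟨p, i, hp, hi⟩ := IsLabelling.triangle.exists_leaf hf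
    obtain rfl : p = [] := by
      rcases p with _ | ⟨c, p⟩
      · rfl
      · exact absurd (hp.2 c p rfl) (Finset.notMem_empty _)
    exact ⟨_, _, IsLabelling.triangle.insert hp hi, _, rfl, rfl⟩
  | step f d _ hf ih =>
    obtain ⟨S, ℓ, h, e, he, hs⟩ := ih
    obtain ⟨p, i, hp, hi⟩ := h.exists_leaf hf
    exact ⟨_, _, h.insert hp hi, Sum.inl d, rfl, (h.origin_iff.1 he).symm.trans hs⟩
  | iso e d _ ih =>
    obtain ⟨S, ℓ, h, d', hd, hs⟩ := ih
    refine ⟨_, _, h.of_iso e, e.toEquiv d, rfl, ?_⟩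
    rw [Function.comp, Equiv.symm_apply_apply, ← h.origin_iff.1 hd, hs]

/-- The labelling built along the construction that starts with `v` may differ from `ℓ`, but
`tree_unique` gives both the same tree, so the degree is the same for all constructions. -/
theorem IsFirstInserted.degree_eq {M : RootedMap D} {v : M.Vertex} (h : IsFirstInserted M v)
    {ℓ : D → DartLabel} (hℓ : IsLabelling S M ℓ) :
    M.degree v = 3 + cornerCount S (Sum.inr []) := by
  obtain ⟨S', ℓ', h', d, rfl, hd⟩ := h.exists_isLabelling
  rw [h'.tree_unique hℓ] at h'
  exact h'.degree_eq hd

end RootedMap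

namespace StackTriangulation

open RootedMap StackCode

variable {n : ℕ}

/-- The nodes of the tree associated with a stack-triangulation. -/
noncomputable def tree (t : StackTriangulation n) : Finset (List (Fin 3)) :=
  t.rep_isStack.exists_isLabelling.choose

/-- The labelling of the darts by the tree. -/
noncomputable def label (t : StackTriangulation n) : Fin (6 * n) → DartLabel :=
  t.rep_isStack.exists_isLabelling.choose_spec.choose

theorem isLabelling (t : StackTriangulation n) : IsLabelling t.tree t.rep t.label :=
  t.rep_isStack.exists_isLabelling.choose_spec.choose_spec.1

theorem card_tree (t : StackTriangulation n) : t.tree.card + 1 = n :=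
  t.rep_isStack.exists_isLabelling.choose_spec.choose_spec.2

theorem tree_injective : Function.Injective (tree : StackTriangulation n → _) := by
  intro t t' h
  have ht := t.isLabelling
  rw [h] at ht
  have := ht.nonempty_iso t'.isLabelling
  rw [← Quotient.out_eq t, ← Quotient.out_eq t']
  exact Quotient.sound this

theorem exists_tree_eq {S : Finset (List (Fin 3))} (hS : IsTree S) (hn : S.card = n) :
    ∃ t : StackTriangulation (n + 1), t.tree = S := by
  obtain ⟨M, ℓ, hM, h⟩ := exists_map_of_isTree n S hS hn
  refine ⟨Quotient.mk _ ⟨M, hM⟩, ?_⟩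
  obtain ⟨e⟩ := Quotient.exact (Quotient.out_eq (Quotient.mk (stackSetoid (n + 1)) ⟨M, hM⟩))
  exact (isLabelling _).tree_unique (h.of_iso e.symm)

/-- The internal vertices are in bijection with the nodes of the tree. -/
theorem exists_vertexEquiv (t : StackTriangulation n) :
    ∃ e : t.tree ≃ t.InternalVertex,
      ∀ q, t.rep.degree (e q).1 = 3 + cornerCount t.tree (Sum.inr q.1) := by
  have h := t.isLabelling
  choose d hd using fun q : t.tree => h.exists_dart q.2 (0, true)
  have hs : ∀ q, source (t.label (d q)) = Sum.inr q.1 := fun q => by rw [hd]; rfl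
  let φ : t.tree → t.InternalVertex := fun q => ⟨t.rep.origin (d q), h.isInternal_iff.2 ⟨_, hs q⟩⟩
  have hφ : Function.Bijective φ := by
    constructor
    · intro q q' hq
      have := h.origin_iff.1 (congrArg Subtype.val hq)
      rw [hs, hs] at this
      exact Subtype.ext (by simpa using this)
    · rintro ⟨v, hv⟩
      obtain ⟨e, rfl⟩ := Quotient.exists_rep v
      obtain ⟨q, hq⟩ := h.isInternal_iff.1 hv
      exact ⟨⟨q, source_mem h.tree (h.inDarts e) hq⟩,
        Subtype.ext (h.origin_iff.2 ((hs _).trans hq.symm))⟩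
  exact ⟨Equiv.ofBijective φ hφ, fun q => h.degree_eq (hs q)⟩

end StackTriangulation

/-! ### Ternary trees -/

/-- Ternary trees. -/
inductive TTree : Type
  | leaf : TTree
  | node (a b c : TTree) : TTree

namespace TTree

open StackCode

/-- The number of nodes. -/
def size : TTree → ℕ
  | leaf => 0
  | node a b c => a.size + b.size + c.size + 1

/-- `t.arm i` is the number of insertions described by `t` that increase the degree of the corner
`i` of the face in which they take place. -/
def arm : TTree → Fin 3 → ℕ
  | leaf => 0
  | node a b c => ![1 + a.arm 0 + c.arm 1, 1 + a.arm 1 + b.arm 0, 1 + b.arm 1 + c.arm 0]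

/-- The number of insertions that increase the degree of the root node. -/
def rootCount : TTree → ℕ
  | leaf => 0
  | node a b c => a.arm 2 + b.arm 2 + c.arm 2

/-- The number of nodes whose degree is increased by `k` insertions. -/
def hits (k : ℕ) : TTree → ℕ
  | leaf => 0
  | node a b c => (if rootCount (node a b c) = k then 1 else 0) +
      (a.hits k + b.hits k + c.hits k)

/-- Prolongation of positions at the root. -/
def graft (c : Fin 3) : List (Fin 3) ↪ List (Fin 3) := ⟨(· ++ [c]), List.append_left_injective [c]⟩

/-- The positions of the nodes. -/
def nodes : TTree → Finset (List (Fin 3))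
  | leaf => ∅
  | node a b c => insert [] (a.nodes.map (graft 0) ∪ b.nodes.map (graft 1) ∪ c.nodes.map (graft 2))

@[simp] theorem graft_apply (c : Fin 3) (p : List (Fin 3)) : graft c p = p ++ [c] := rfl

theorem append_mem_nodes (a b c : TTree) (i : Fin 3) (p : List (Fin 3)) :
    p ++ [i] ∈ (node a b c).nodes ↔ p ∈ (![a, b, c] i).nodes := by
  have h : ∀ j, (p ++ [i] ∈ (![a, b, c] j).nodes.map (graft j)) ↔
      j = i ∧ p ∈ (![a, b, c] i).nodes := by
    intro j
    simp only [Finset.mem_map, graft_apply]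
    constructor
    · rintro ⟨q, hq, he⟩
      obtain ⟨rfl, h⟩ := List.append_inj' he rfl
      obtain rfl : j = i := by simpa using h
      exact ⟨rfl, hq⟩
    · rintro ⟨rfl, hp⟩
      exact ⟨p, hp, rfl⟩
  have h0 := h 0
  have h1 := h 1
  have h2 := h 2
  simp only [Matrix.cons_val] at h0 h1 h2
  rw [nodes, Finset.mem_insert, Finset.mem_union, Finset.mem_union, h0, h1, h2]
  have : p ++ [i] ≠ [] := by simp
  constructor
  · rintro (h | (⟨-, h⟩ | ⟨-, h⟩) | ⟨-, h⟩)
    · exact absurd h this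
    all_goals exact h
  · intro h
    have : (0 : Fin 3) = i ∨ (1 : Fin 3) = i ∨ (2 : Fin 3) = i :=
      (by decide : ∀ i : Fin 3, (0 : Fin 3) = i ∨ (1 : Fin 3) = i ∨ (2 : Fin 3) = i) i
    tauto

theorem nil_mem_nodes (a b c : TTree) : [] ∈ (node a b c).nodes := Finset.mem_insert_self _ _

theorem isTree_nodes (t : TTree) : IsTree t.nodes := by
  induction t with
  | leaf => exact fun _ _ h => absurd h (Finset.notMem_empty _)
  | node a b c ha hb hc =>
    intro d p hp
    rcases List.eq_nil_or_concat p with rfl | ⟨p, i, rfl⟩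
    · exact nil_mem_nodes a b c
    · rw [List.concat_eq_append] at *
      rw [← List.cons_append, append_mem_nodes] at hp
      rw [append_mem_nodes]
      revert hp
      revert i
      exact forall_fin_three (ha d p) (hb d p) (hc d p)

theorem sum_nodes {α : Type} [AddCommMonoid α] (a b c : TTree) (g : List (Fin 3) → α) :
    ∑ p ∈ (node a b c).nodes, g p = g [] + (∑ p ∈ a.nodes, g (p ++ [0]) +
      ∑ p ∈ b.nodes, g (p ++ [1]) + ∑ p ∈ c.nodes, g (p ++ [2])) := by
  have hdis : ∀ (i j : Fin 3) (A B : Finset (List (Fin 3))), i ≠ j →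
      Disjoint (A.map (graft i)) (B.map (graft j)) := by
    intro i j A B hij
    rw [Finset.disjoint_left]
    intro p hp hp'
    obtain ⟨q, -, rfl⟩ := Finset.mem_map.1 hp
    obtain ⟨q', -, h⟩ := Finset.mem_map.1 hp'
    have := (List.append_inj' h rfl).2
    exact hij (by simpa using this.symm)
  rw [nodes, Finset.sum_insert, Finset.sum_union, Finset.sum_union, Finset.sum_map,
    Finset.sum_map, Finset.sum_map]
  · rfl
  · exact hdis _ _ _ _ (by decide)
  · rw [Finset.disjoint_union_left]
    exact ⟨hdis _ _ _ _ (by decide), hdis _ _ _ _ (by decide)⟩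
  · simp

theorem card_nodes (t : TTree) : t.nodes.card = t.size := by
  induction t with
  | leaf => rfl
  | node a b c ha hb hc =>
    rw [Finset.card_eq_sum_ones, sum_nodes, ← Finset.card_eq_sum_ones, ← Finset.card_eq_sum_ones,
      ← Finset.card_eq_sum_ones, ha, hb, hc, size]
    ring

theorem nodes_injective : Function.Injective nodes := by
  intro t
  induction t with
  | leaf =>
    rintro (_ | ⟨a, b, c⟩) h
    · rfl
    · have := nil_mem_nodes a b c
      rw [← h] at this
      exact absurd this (Finset.notMem_empty _)
  | node a b c ha hb hc =>
    rintro (_ | ⟨a', b', c'⟩) h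
    · have := nil_mem_nodes a b c
      rw [h] at this
      exact absurd this (Finset.notMem_empty _)
    · have key : ∀ i, (![a, b, c] i).nodes = (![a', b', c'] i).nodes := by
        intro i
        ext p
        rw [← append_mem_nodes, ← append_mem_nodes, h]
      obtain rfl : a = a' := ha (key 0)
      obtain rfl : b = b' := hb (key 1)
      obtain rfl : c = c' := hc (key 2)
      rfl

theorem exists_nodes_eq (n : ℕ) : ∀ S : Finset (List (Fin 3)), IsTree S → S.card < n →
    ∃ t : TTree, t.nodes = S := by
  induction n with
  | zero => intro S _ h; omega
  | succ n ih =>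
    intro S hS hn
    have hnil : ∀ p, p ∈ S → [] ∈ S := by
      intro p
      induction p with
      | nil => exact id
      | cons d p ihp => exact fun h => ihp (hS d p h)
    rcases S.eq_empty_or_nonempty with rfl | ⟨p, hp⟩
    · exact ⟨leaf, rfl⟩
    have hmem := hnil p hp
    have hex : ∀ i : Fin 3, ∃ t : TTree, ∀ p, p ∈ t.nodes ↔ p ++ [i] ∈ S := by
      intro i
      have hsub : ∀ p, p ∈ S.preimage (graft i) (graft i).injective.injOn ↔ p ++ [i] ∈ S :=
        fun p => Finset.mem_preimage
      obtain ⟨t, ht⟩ := ih (S.preimage (graft i) (graft i).injective.injOn)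
        (fun d p hp => (hsub p).2 (hS d _ ((hsub _).1 hp))) (by
          refine lt_of_lt_of_le ?_ (Nat.lt_succ_iff.1 hn)
          rw [← Finset.card_map (graft i)]
          refine Finset.card_lt_card ((Finset.ssubset_iff_of_subset ?_).2 ⟨[], hmem, ?_⟩)
          · intro q hq
            obtain ⟨p, hp, rfl⟩ := Finset.mem_map.1 hq
            exact (hsub p).1 hp
          · simp)
      exact ⟨t, fun p => by rw [ht, hsub]⟩
    choose t ht using hex
    refine ⟨node (t 0) (t 1) (t 2), ?_⟩
    ext p
    rcases List.eq_nil_or_concat p with rfl | ⟨p, i, rfl⟩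
    · exact ⟨fun _ => hmem, fun _ => nil_mem_nodes _ _ _⟩
    · rw [List.concat_eq_append, append_mem_nodes, ← ht]
      revert i
      exact forall_fin_three Iff.rfl Iff.rfl Iff.rfl

/-! Recursive computation of the degrees. -/

theorem cornerCount_eq_sum (S : Finset (List (Fin 3))) (v : VertexLabel) :
    cornerCount S v = ∑ p ∈ S, ∑ j, if corner p j = v then 1 else 0 := by
  rw [cornerCount, Finset.card_filter, Finset.sum_product]

/-- The vertices seen from the `c`-th subtree of the root. -/
def liftVertex (c : Fin 3) : VertexLabel → VertexLabel :=
  Sum.elim (corner [c]) fun q => Sum.inr (q ++ [c])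

theorem sum_lift {c : Fin 3} {v w : VertexLabel} (h : ∀ x, liftVertex c x = v ↔ x = w)
    (S : Finset (List (Fin 3))) :
    (∑ p ∈ S, ∑ j, if corner (p ++ [c]) j = v then 1 else 0) = cornerCount S w := by
  rw [cornerCount_eq_sum]
  refine Finset.sum_congr rfl fun p _ => Finset.sum_congr rfl fun j _ => ?_
  rw [corner_append]
  exact if_congr (h _) rfl rfl

theorem sum_lift_zero {c : Fin 3} {v : VertexLabel} (h : ∀ x, liftVertex c x ≠ v)
    (S : Finset (List (Fin 3))) :
    (∑ p ∈ S, ∑ j, if corner (p ++ [c]) j = v then 1 else 0) = 0 := by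
  refine Finset.sum_eq_zero fun p _ => Finset.sum_eq_zero fun j _ => ?_
  rw [corner_append]
  exact if_neg (h _)

theorem liftVertex_injective (c : Fin 3) : Function.Injective (liftVertex c) := by
  rintro (i | p) (j | q) h
  · exact congrArg _ (corner_injective [c] h)
  · have := corner_eq_inr (show corner [c] i = Sum.inr (q ++ [c]) from h)
    simp at this
  · have := corner_eq_inr (show corner [c] j = Sum.inr (p ++ [c]) from h.symm)
    simp at this
  · exact congrArg _ (List.append_left_injective [c] (Sum.inr_injective h))

theorem liftVertex_eq_iff {c : Fin 3} {v w : VertexLabel} (h : liftVertex c w = v)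
    (x : VertexLabel) : liftVertex c x = v ↔ x = w := by
  rw [← h, (liftVertex_injective c).eq_iff]

/-- The face `[c]` has the corners `c`, `c + 1` and the new vertex; the remaining outer corner is
not visible from it. -/
theorem liftVertex_ne {c d : Fin 3} (h : d ≠ c) (h' : d ≠ c + 1) (x : VertexLabel) :
    liftVertex c x ≠ Sum.inl d := by
  rcases x with i | p
  · revert i
    refine forall_fin_three ?_ ?_ ?_ <;> intro e <;>
      simp only [liftVertex, corner, Sum.elim_inl, Matrix.cons_val, Sum.inl.injEq,
        reduceCtorEq] at e
    · exact h e.symm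
    · exact h' e.symm
  · simp [liftVertex]

theorem sum_corner_nil_inl (i : Fin 3) :
    (∑ j, if corner [] j = (Sum.inl i : VertexLabel) then 1 else 0) = 1 := by
  simp [corner]

theorem sum_corner_nil_inr (p : List (Fin 3)) :
    (∑ j, if corner [] j = (Sum.inr p : VertexLabel) then 1 else 0) = 0 := by
  simp [corner]

/-- The root insertion touches corner `i` once. Afterwards this corner is in place 0 of the face
`[i]`, in place 1 of `[i - 1]`, and absent from the third face. -/
theorem cornerCount_inl (t : TTree) : ∀ i, cornerCount t.nodes (Sum.inl i) = t.arm i := by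
  induction t with
  | leaf => intro i; simp [cornerCount, nodes, arm]
  | node a b c ha hb hc =>
    refine forall_fin_three ?_ ?_ ?_ <;>
      rw [cornerCount_eq_sum, sum_nodes, sum_corner_nil_inl]
    · rw [sum_lift (liftVertex_eq_iff (c := 0) (v := Sum.inl 0) (w := Sum.inl 0) rfl),
        sum_lift_zero (liftVertex_ne (by decide) (by decide)),
        sum_lift (liftVertex_eq_iff (c := 2) (v := Sum.inl 0) (w := Sum.inl 1) rfl), ha, hc]
      simp [arm, add_assoc]
    · rw [sum_lift (liftVertex_eq_iff (c := 0) (v := Sum.inl 1) (w := Sum.inl 1) rfl),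
        sum_lift (liftVertex_eq_iff (c := 1) (v := Sum.inl 1) (w := Sum.inl 0) rfl),
        sum_lift_zero (liftVertex_ne (by decide) (by decide)), ha, hb]
      simp [arm, add_assoc]
    · rw [sum_lift_zero (liftVertex_ne (by decide) (by decide)),
        sum_lift (liftVertex_eq_iff (c := 1) (v := Sum.inl 2) (w := Sum.inl 1) rfl),
        sum_lift (liftVertex_eq_iff (c := 2) (v := Sum.inl 2) (w := Sum.inl 0) rfl), hb, hc]
      simp [arm, add_assoc]

theorem cornerCount_root (t : TTree) : cornerCount t.nodes (Sum.inr []) = t.rootCount := by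
  cases t with
  | leaf => simp [cornerCount, nodes, rootCount]
  | node a b c =>
    rw [cornerCount_eq_sum, sum_nodes, sum_corner_nil_inr,
      sum_lift (liftVertex_eq_iff (c := 0) (v := Sum.inr []) (w := Sum.inl 2) rfl),
      sum_lift (liftVertex_eq_iff (c := 1) (v := Sum.inr []) (w := Sum.inl 2) rfl),
      sum_lift (liftVertex_eq_iff (c := 2) (v := Sum.inr []) (w := Sum.inl 2) rfl), cornerCount_inl, cornerCount_inl,
      cornerCount_inl, zero_add, rootCount]

theorem cornerCount_append (a b c : TTree) (i : Fin 3) (q : List (Fin 3)) :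
    cornerCount (node a b c).nodes (Sum.inr (q ++ [i])) =
      cornerCount (![a, b, c] i).nodes (Sum.inr q) := by
  have hne : ∀ j, j ≠ i → ∀ x, liftVertex j x ≠ Sum.inr (q ++ [i]) := by
    rintro j hj (k | p) h
    · have := corner_eq_inr (show corner [j] k = Sum.inr (q ++ [i]) from h)
      simp at this
    · have := (List.append_inj' (Sum.inr_injective h) rfl).2
      exact hj (by simpa using this)
  rw [cornerCount_eq_sum, sum_nodes, sum_corner_nil_inr, zero_add]
  have heq : ∀ x, liftVertex i x = Sum.inr (q ++ [i]) ↔ x = Sum.inr q := liftVertex_eq_iff rfl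
  revert hne heq
  revert i
  refine forall_fin_three (fun hne heq => ?_) (fun hne heq => ?_) (fun hne heq => ?_)
  · rw [sum_lift heq, sum_lift_zero (hne _ (by decide)), sum_lift_zero (hne _ (by decide))]
    rfl
  · rw [sum_lift heq, sum_lift_zero (hne _ (by decide)), sum_lift_zero (hne _ (by decide))]
    simp
  · rw [sum_lift heq, sum_lift_zero (hne _ (by decide)), sum_lift_zero (hne _ (by decide))]
    simp

theorem sum_cornerCount (k : ℕ) (t : TTree) :
    (∑ q ∈ t.nodes, if cornerCount t.nodes (Sum.inr q) = k then 1 else 0) = t.hits k := by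
  induction t with
  | leaf => rfl
  | node a b c ha hb hc =>
    rw [sum_nodes, cornerCount_root]
    simp only [cornerCount_append]
    rw [hits, ← ha, ← hb, ← hc]
    rfl

end TTree

/-! ### Enumeration of forests -/

noncomputable instance : DecidableEq TTree := Classical.decEq _

namespace TTree

/-- Joins the first three trees of a forest at a new root. -/
def join : List TTree → List TTree
  | a :: b :: c :: l => node a b c :: l
  | l => l

/-- The forests of `j` trees with `n` nodes. -/
noncomputable def forests : ℕ → ℕ → Finset (List TTree)
  | 0, 0 => {[]}
  | _ + 1, 0 => ∅
  | 0, j + 1 => (forests 0 j).image (List.cons leaf)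
  | n + 1, j + 1 => (forests (n + 1) j).image (List.cons leaf) ∪ (forests n (j + 3)).image join
termination_by n j => (n, j)

theorem exists_cons_of_length {j : ℕ} {l : List TTree} (h : l.length = j + 3) :
    ∃ a b c l', l = a :: b :: c :: l' ∧ l'.length = j := by
  match l, h with
  | a :: b :: c :: l', h => exact ⟨a, b, c, l', rfl, by simpa using h⟩

theorem mem_forests (n j : ℕ) (l : List TTree) :
    l ∈ forests n j ↔ l.length = j ∧ (l.map size).sum = n := by
  induction n, j using forests.induct generalizing l with
  | case1 =>
    rw [forests, Finset.mem_singleton]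
    constructor
    · rintro rfl
      simp
    · exact fun h => List.eq_nil_of_length_eq_zero h.1
  | case2 n =>
    rw [forests]
    constructor
    · intro h
      exact absurd h (Finset.notMem_empty _)
    · rintro ⟨h, h'⟩
      obtain rfl := List.eq_nil_of_length_eq_zero h
      simp at h'
  | case3 j ih =>
    rw [forests, Finset.mem_image]
    constructor
    · rintro ⟨l, hl, rfl⟩
      obtain ⟨h, h'⟩ := (ih l).1 hl
      simp [h, h', size]
    · rintro ⟨h, h'⟩
      rcases l with _ | ⟨_ | ⟨a, b, c⟩, l⟩
      · simp at h
      · exact ⟨l, (ih l).2 (by simpa [size] using And.intro h h'), rfl⟩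
      · simp [size] at h'
  | case4 n j ih ih' =>
    rw [forests, Finset.mem_union, Finset.mem_image, Finset.mem_image]
    constructor
    · rintro (⟨l, hl, rfl⟩ | ⟨l, hl, rfl⟩)
      · obtain ⟨h, h'⟩ := (ih l).1 hl
        simp [h, h', size]
      · obtain ⟨h, h'⟩ := (ih' l).1 hl
        obtain ⟨a, b, c, l, rfl, rfl⟩ := exists_cons_of_length h
        simp only [List.map_cons, List.sum_cons] at h'
        simp only [join, List.length_cons, List.map_cons, List.sum_cons, size, true_and]
        omega
    · rintro ⟨h, h'⟩
      rcases l with _ | ⟨_ | ⟨a, b, c⟩, l⟩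
      · simp at h
      · exact Or.inl ⟨l, (ih l).2 (by simpa [size] using And.intro h h'), rfl⟩
      · refine Or.inr ⟨a :: b :: c :: l, (ih' _).2 ?_, rfl⟩
        simp only [List.length_cons, List.map_cons, List.sum_cons, size] at h h' ⊢
        omega

theorem sum_forests_zero (j : ℕ) (g : List TTree → ℕ) :
    ∑ l ∈ forests 0 j, g l = g (List.replicate j leaf) := by
  induction j generalizing g with
  | zero => simp [forests]
  | succ j ih =>
    rw [forests, Finset.sum_image (List.cons_injective.injOn), ih (fun l => g (leaf :: l))]
    rfl

theorem sum_forests_succ_zero (n : ℕ) (g : List TTree → ℕ) : ∑ l ∈ forests (n + 1) 0, g l = 0 := by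
  simp [forests]

/-- Decomposition by the first tree: a leaf is dropped, a node is replaced by its three subtrees.
The counting arguments rest on this recurrence, applied to various statistics `g`. -/
theorem sum_forests_succ (n j : ℕ) (g : List TTree → ℕ) :
    ∑ l ∈ forests (n + 1) (j + 1), g l =
      ∑ l ∈ forests (n + 1) j, g (leaf :: l) + ∑ l ∈ forests n (j + 3), g (join l) := by
  rw [forests, Finset.sum_union, Finset.sum_image (List.cons_injective.injOn), Finset.sum_image]
  · intro l hl l' hl' h
    obtain ⟨a, b, c, l, rfl, -⟩ := exists_cons_of_length ((mem_forests _ _ _).1 hl).1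
    obtain ⟨a', b', c', l', rfl, -⟩ := exists_cons_of_length ((mem_forests _ _ _).1 hl').1
    simp only [join, List.cons.injEq, node.injEq] at h
    obtain ⟨⟨rfl, rfl, rfl⟩, rfl⟩ := h
    rfl
  · rw [Finset.disjoint_left]
    intro x hx hx'
    obtain ⟨l, -, rfl⟩ := Finset.mem_image.1 hx
    obtain ⟨l', hl', h⟩ := Finset.mem_image.1 hx'
    obtain ⟨a', b', c', l', rfl, -⟩ := exists_cons_of_length ((mem_forests _ _ _).1 hl').1
    simp [join] at h

theorem sum_join {n j : ℕ} (g h : List TTree → ℕ)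
    (e : ∀ a b c l, g (node a b c :: l) = h (a :: b :: c :: l)) :
    ∑ l ∈ forests n (j + 3), g (join l) = ∑ l ∈ forests n (j + 3), h l := by
  refine Finset.sum_congr rfl fun l hl => ?_
  obtain ⟨a, b, c, l, rfl, -⟩ := exists_cons_of_length ((mem_forests _ _ _).1 hl).1
  exact e a b c l

/-- The number of forests of `j` trees with `n` nodes. -/
noncomputable def forestCard (n j : ℕ) : ℕ := (forests n j).card

theorem forestCard_zero (j : ℕ) : forestCard 0 j = 1 := by
  rw [forestCard, Finset.card_eq_sum_ones, sum_forests_zero]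

theorem forestCard_succ_zero (n : ℕ) : forestCard (n + 1) 0 = 0 := by
  rw [forestCard, Finset.card_eq_sum_ones, sum_forests_succ_zero]

theorem forestCard_succ (n j : ℕ) :
    forestCard (n + 1) (j + 1) = forestCard (n + 1) j + forestCard n (j + 3) := by
  simp only [forestCard, Finset.card_eq_sum_ones, sum_forests_succ]

theorem choose_succ_ratio (M m : ℕ) (h : m ≤ M) :
    (M.choose (m + 1) : ℚ) * (m + 1) = M.choose m * (M - m) := by
  have := Nat.choose_succ_right_eq M m
  rw [← Nat.cast_sub h]
  exact_mod_cast this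

/-- The cycle lemma count j/(3n + j) C(3n + j, n), obtained here from the recurrence and Pascal's
rule. In product form it also covers n = j = 0. -/
theorem forestCard_mul (n j : ℕ) :
    (forestCard n j : ℚ) * (3 * n + j) = j * (3 * n + j).choose n := by
  induction n generalizing j with
  | zero => simp [forestCard_zero]
  | succ n ih =>
    induction j with
    | zero => simp [forestCard_succ_zero]
    | succ j ihj =>
      have h1 := ih (j + 3)
      rw [show 3 * n + (j + 3) = 3 * (n + 1) + j by ring] at h1
      have h2 := choose_succ_ratio (3 * (n + 1) + j) n (by omega)
      rw [forestCard_succ, show 3 * (n + 1) + (j + 1) = 3 * (n + 1) + j + 1 by ring,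
        Nat.choose_succ_succ']
      push_cast at *
      set x : ℚ := ((3 * (n + 1) + j).choose n : ℚ)
      set y : ℚ := ((3 * (n + 1) + j).choose (n + 1) : ℚ)
      set F : ℚ := (forestCard (n + 1) j : ℚ)
      set G : ℚ := (forestCard n (j + 3) : ℚ)
      have hM : (3 * ((n : ℚ) + 1) + j) ≠ 0 := by positivity
      refine mul_left_cancel₀ hM ?_
      linear_combination (3 * (n + 1) + j + 1 : ℚ) * (ihj + h1) - 3 * h2

/-! ### Ballot numbers and forests with marked corners -/

/-- The number of forests of `j` binary trees with `k` nodes. -/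
def ballot : ℕ → ℕ → ℕ
  | _, 0 => 1
  | 0, _ + 1 => 0
  | j + 1, k + 1 => ballot j (k + 1) + ballot (j + 2) k
termination_by j k => (k, j)

theorem ballot_zero (j : ℕ) : ballot j 0 = 1 := by rw [ballot]

theorem ballot_zero_succ (k : ℕ) : ballot 0 (k + 1) = 0 := by rw [ballot]

theorem ballot_succ (j k : ℕ) : ballot (j + 1) (k + 1) = ballot j (k + 1) + ballot (j + 2) k := by
  rw [ballot]

theorem ballot_mul (j k : ℕ) :
    (ballot j k : ℚ) * (2 * k + j) = j * (2 * k + j).choose k := by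
  induction k generalizing j with
  | zero => simp [ballot_zero]
  | succ k ih =>
    induction j with
    | zero => simp [ballot_zero_succ]
    | succ j ihj =>
      have h1 := ih (j + 2)
      rw [show 2 * k + (j + 2) = 2 * (k + 1) + j by ring] at h1
      have h2 := choose_succ_ratio (2 * (k + 1) + j) k (by omega)
      rw [ballot_succ, show 2 * (k + 1) + (j + 1) = 2 * (k + 1) + j + 1 by ring,
        Nat.choose_succ_succ']
      push_cast at *
      set x : ℚ := ((2 * (k + 1) + j).choose k : ℚ)
      set y : ℚ := ((2 * (k + 1) + j).choose (k + 1) : ℚ)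
      set F : ℚ := (ballot j (k + 1) : ℚ)
      set G : ℚ := (ballot (j + 2) k : ℚ)
      have hM : (2 * ((k : ℚ) + 1) + j) ≠ 0 := by positivity
      refine mul_left_cancel₀ hM ?_
      linear_combination (2 * (k + 1) + j + 1 : ℚ) * (ihj + h1) - 2 * h2

/-- The number of insertions that increase the degrees of the marked corners, for a forest of which
some trees have a marked corner. -/
def totalArm : List (Option (Fin 3)) → List TTree → ℕ
  | some c :: ms, t :: l => t.arm c + totalArm ms l
  | none :: ms, _ :: l => totalArm ms l
  | _, _ => 0

/-- The corners marked in the three subtrees when the corner `c` is marked. -/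
def childMarks : Fin 3 → List (Option (Fin 3)) :=
  ![[some 0, none, some 1], [some 1, some 0, none], [none, some 1, some 0]]

/-- The binary branching: a node under a marked corner counts once, passes the mark to two subtrees
and leaves the third one free. -/
theorem totalArm_some_node (i : Fin 3) (ms : List (Option (Fin 3))) (a b c : TTree)
    (l : List TTree) :
    totalArm (some i :: ms) (node a b c :: l) =
      totalArm (childMarks i ++ ms) (a :: b :: c :: l) + 1 := by
  revert i
  refine StackCode.forall_fin_three ?_ ?_ ?_ <;> simp [totalArm, childMarks, arm] <;> ring

theorem totalArm_some_leaf (i : Fin 3) (ms : List (Option (Fin 3))) (l : List TTree) :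
    totalArm (some i :: ms) (leaf :: l) = totalArm ms l := by
  simp [totalArm, arm]

theorem totalArm_none_cons (ms : List (Option (Fin 3))) (t : TTree) (l : List TTree) :
    totalArm (none :: ms) (t :: l) = totalArm ms l := rfl

theorem totalArm_replicate (ms : List (Option (Fin 3))) (j : ℕ) :
    totalArm ms (List.replicate j leaf) = 0 := by
  induction ms generalizing j with
  | nil => simp [totalArm]
  | cons m ms ih =>
    cases j with
    | zero => simp [totalArm]
    | succ j => cases m <;> simp [List.replicate_succ, totalArm, arm, ih]

/-- The joint enumeration by the number of nodes and the total number of insertions that increase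
the degrees of the marked corners. -/
theorem sum_totalArm (n : ℕ) : ∀ (ms : List (Option (Fin 3))) (j i k : ℕ),
    ms.countP Option.isSome = j → ms.countP Option.isNone = i →
    (∑ l ∈ forests n ms.length, if totalArm ms l = k then 1 else 0) =
      if k ≤ n then ballot j k * forestCard (n - k) (k + i) else 0 := by
  induction n with
  | zero =>
    intro ms j i k _ _
    rw [sum_forests_zero, totalArm_replicate]
    rcases k with _ | k
    · simp [ballot_zero, forestCard_zero]
    · simp
  | succ n ih =>
    intro ms
    induction ms with
    | nil =>
      rintro j i k rfl rfl
      rw [List.length_nil, sum_forests_succ_zero]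
      rcases k with _ | k
      · simp [forestCard_succ_zero]
      · simp [ballot_zero_succ]
    | cons m ms ihm =>
      intro j i k hj hi
      rw [List.length_cons, sum_forests_succ]
      -- An unmarked first tree reproduces the recurrence of `forestCard`. A marked one reproduces
      -- that of `ballot`: a node turns one mark into two and creates one free tree, whence the `k +
      -- i` free trees in the end.
      rcases m with _ | c
      · simp only [List.countP_cons, Option.isSome_none, Option.isNone_none, if_true,
          Bool.false_eq_true, if_false, add_zero] at hj hi
        rw [sum_join (fun l => if totalArm (none :: ms) l = k then 1 else 0)
          (fun l => if totalArm (none :: none :: none :: ms) l = k then 1 else 0)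
          (fun a b c l => rfl)]
        rw [Finset.sum_congr rfl (g := fun l => if totalArm ms l = k then 1 else 0)
          (fun l _ => by rw [totalArm_none_cons]), ihm j _ k hj rfl]
        have := ih (none :: none :: none :: ms) j (ms.countP Option.isNone + 3) k (by simpa using hj)
          (by simp)
        simp only [List.length_cons] at this
        rw [this, ← hi]
        rcases lt_trichotomy k (n + 1) with hk | rfl | hk
        · obtain ⟨d, rfl⟩ : ∃ d, n = k + d := ⟨n - k, by omega⟩
          rw [if_pos (by omega), if_pos (by omega), if_pos (by omega),
            show k + d + 1 - k = d + 1 by omega, show k + d - k = d by omega, ← add_assoc,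
            ← add_assoc, forestCard_succ]
          ring
        · simp [forestCard_zero]
        · rw [if_neg (by omega), if_neg (by omega), if_neg (by omega)]
      · simp only [List.countP_cons, Option.isSome_some, Option.isNone_some, if_true,
          Bool.false_eq_true, if_false, add_zero] at hj hi
        rw [sum_join (fun l => if totalArm (some c :: ms) l = k then 1 else 0)
          (fun l => if totalArm (childMarks c ++ ms) l + 1 = k then 1 else 0)
          (fun a b d l => by rw [totalArm_some_node])]
        rw [Finset.sum_congr rfl (g := fun l => if totalArm ms l = k then 1 else 0)
          (fun l _ => by rw [totalArm_some_leaf]), ihm _ i k rfl hi, ← hj]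
        rcases k with _ | k
        · simp [ballot_zero]
        · have hl : (childMarks c ++ ms).length = ms.length + 3 := by
            revert c
            exact StackCode.forall_fin_three (by simp [childMarks]) (by simp [childMarks])
              (by simp [childMarks])
          have := ih (childMarks c ++ ms) (ms.countP Option.isSome + 2) (i + 1) k (by
            revert c
            exact StackCode.forall_fin_three (by simp [childMarks])
              (by simp [childMarks])
              (by simp [childMarks])) (by
            rw [← hi]
            revert c
            exact StackCode.forall_fin_three (by simp [childMarks])
              (by simp [childMarks])
              (by simp [childMarks]))
          rw [hl] at this
          simp only [add_left_inj]
          rw [this, ballot_succ]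
          by_cases hk : k ≤ n
          · rw [if_pos (by omega), if_pos (by omega), if_pos (by omega),
              show n + 1 - (k + 1) = n - k by omega, show k + (i + 1) = k + 1 + i by ring]
            ring
          · rw [if_neg (by omega), if_neg (by omega), if_neg (by omega)]

theorem totalArm_none (l : List TTree) (j : ℕ) :
    totalArm (List.replicate j none) l = 0 := by
  induction j generalizing l with
  | zero => simp [totalArm]
  | succ j ih => cases l <;> simp [List.replicate_succ, totalArm, ih]

/-- Forests whose first three trees are the subtrees of a vertex of given degree. -/
theorem sum_rootCount (n j k : ℕ) :
    (∑ l ∈ forests n (j + 3), if rootCount ((join l).headD leaf) = k then 1 else 0) =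
      if k ≤ n then ballot 3 k * forestCard (n - k) (k + j) else 0 := by
  -- The new vertex is corner 2 of each of its three faces; the other `j` trees are unmarked.
  rw [sum_join (fun l => if rootCount (l.headD leaf) = k then 1 else 0)
    (fun l => if totalArm (some 2 :: some 2 :: some 2 :: List.replicate j none) l = k then 1 else 0)]
  · have := sum_totalArm n (some 2 :: some 2 :: some 2 :: List.replicate j none) 3 j k
      (by simp [List.countP_replicate])
      (by simp [List.countP_replicate])
    simp only [List.length_cons, List.length_replicate] at this
    exact this
  · intro a b c l
    simp [totalArm, rootCount, totalArm_none l, add_assoc]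

/-- The total number of vertices of given degree. -/
theorem sum_hits (n j k : ℕ) :
    (∑ l ∈ forests n j, (l.map (hits k)).sum) =
      if k + 1 ≤ n then j * ballot 3 k * (3 * (n - 1 - k) + k + j - 1).choose (n - 1 - k)
      else 0 := by
  induction n generalizing j with
  | zero =>
    rw [sum_forests_zero]
    simp [hits]
  | succ n ih =>
    induction j with
    -- The factor `j` vanishes, so the truncated subtraction is harmless.
    | zero => simp [sum_forests_succ_zero]
    | succ j ihj =>
      -- If the first tree is a node, its root is counted by `sum_rootCount` and all other nodes lie
      -- in a forest of `j + 3` trees.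
      rw [sum_forests_succ, sum_join (n := n) (j := j) (fun l => (l.map (hits k)).sum)
        (fun l => (if rootCount ((join l).headD leaf) = k then 1 else 0) + (l.map (hits k)).sum)
        (fun a b c l => by simp [hits, join]; ring), Finset.sum_add_distrib, sum_rootCount, ih]
      simp only [List.map_cons, List.sum_cons, hits, zero_add]
      rw [ihj]
      rcases lt_trichotomy n k with hk | rfl | hk
      · rw [if_neg (by omega), if_neg (by omega), if_neg (by omega), if_neg (by omega)]
        rfl
      · simp [forestCard_zero]
        ring
      · obtain ⟨m, rfl⟩ : ∃ m, n = k + 1 + m := ⟨n - (k + 1), by omega⟩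
        rw [if_pos (by omega), if_pos (by omega), if_pos (by omega), if_pos (by omega),
          show k + 1 + m + 1 - 1 - k = m + 1 by omega, show k + 1 + m - 1 - k = m by omega,
          show k + 1 + m - k = m + 1 by omega,
          show 3 * (m + 1) + k + j - 1 = 3 * m + 2 + k + j by omega,
          show 3 * m + k + (j + 3) - 1 = 3 * m + 2 + k + j by omega,
          show 3 * (m + 1) + k + (j + 1) - 1 = 3 * m + 2 + k + j + 1 by omega]
        have h1 := forestCard_mul (m + 1) (k + j)
        have h2 := Nat.add_one_mul_choose_eq (3 * m + 2 + k + j) m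
        rw [show 3 * (m + 1) + (k + j) = 3 * m + 2 + k + j + 1 by ring] at h1
        rw [Nat.choose_succ_succ'] at h1 h2 ⊢
        have h3 := congrArg (Nat.cast : ℕ → ℚ) h2
        push_cast at h1 h3
        have key : ((j * (3 * m + 2 + k + j).choose (m + 1) + (forestCard (m + 1) (k + j) +
            (j + 3) * (3 * m + 2 + k + j).choose m) : ℕ) : ℚ) =
            ((j + 1) * ((3 * m + 2 + k + j).choose m + (3 * m + 2 + k + j).choose (m + 1)) : ℕ) := by
          push_cast
          have hM : (3 * (m : ℚ) + 2 + k + j + 1) ≠ 0 := by positivity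
          refine mul_left_cancel₀ hM ?_
          linear_combination h1 + 3 * h3
        have key' := Nat.cast_injective (R := ℚ) key
        linear_combination ballot 3 k * key'

end TTree

/-! ### The laws of the degrees -/

namespace StackTriangulation

open RootedMap StackCode TTree

/-- The bijection with ternary trees in summed form; a tree is treated as a forest of length one so
that the forest counts apply. -/
theorem sum_tree (n : ℕ) (g : Finset (List (Fin 3)) → ℕ) :
    ∑ t : StackTriangulation (n + 1), g t.tree =
      ∑ l ∈ forests n 1, (l.map fun t => g t.nodes).sum := by
  choose T hT using fun t : StackTriangulation (n + 1) =>
    exists_nodes_eq _ t.tree t.isLabelling.tree (Nat.lt_succ_self _)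
  refine Finset.sum_bij (fun t _ => [T t]) ?_ ?_ ?_ ?_
  · intro t _
    have := t.card_tree
    rw [← hT, card_nodes] at this
    rw [mem_forests]
    simp
    omega
  · intro t _ t' _ h
    refine tree_injective ?_
    rw [← hT, ← hT, (List.cons.inj h).1]
  · intro l hl
    obtain ⟨hl, hn⟩ := (mem_forests _ _ _).1 hl
    obtain ⟨a, rfl⟩ := List.length_eq_one_iff.1 hl
    obtain ⟨t, ht⟩ := exists_tree_eq (isTree_nodes a) (n := n) (by
      rw [card_nodes]
      simpa using hn)
    refine ⟨t, Finset.mem_univ _, ?_⟩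
    rw [nodes_injective ((hT t).trans ht)]
  · intro t _
    simp [hT]

theorem card_eq (n : ℕ) : Fintype.card (StackTriangulation (n + 1)) = forestCard n 1 := by
  rw [Fintype.card_eq_sum_ones, sum_tree n (fun _ => 1), forestCard, Finset.card_eq_sum_ones]
  refine Finset.sum_congr rfl fun l hl => ?_
  simp [((mem_forests _ _ _).1 hl).1]

theorem sum_root (n k : ℕ) :
    (∑ t : StackTriangulation (n + 2), if cornerCount t.tree (Sum.inr []) = k then 1 else 0) =
      if k ≤ n then ballot 3 k * forestCard (n - k) k else 0 := by
  have h := sum_rootCount n 0 k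
  rw [add_zero] at h
  rw [sum_tree (n + 1) (fun S => if cornerCount S (Sum.inr []) = k then 1 else 0),
    sum_forests_succ, sum_forests_succ_zero, zero_add, ← h]
  refine Finset.sum_congr rfl fun l hl => ?_
  obtain ⟨a, b, c, l, rfl, hl'⟩ := exists_cons_of_length ((mem_forests _ _ _).1 hl).1
  obtain rfl := List.eq_nil_of_length_eq_zero hl'
  simp [TTree.join, cornerCount_root]

theorem sum_internal (n k : ℕ) :
    (∑ t : StackTriangulation (n + 2),
        ∑ q ∈ t.tree, if cornerCount t.tree (Sum.inr q) = k then 1 else 0) =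
      if k ≤ n then ballot 3 k * (3 * (n - k) + k).choose (n - k) else 0 := by
  rw [sum_tree (n + 1) (fun S => ∑ q ∈ S, if cornerCount S (Sum.inr q) = k then 1 else 0)]
  simp only [sum_cornerCount]
  rw [sum_hits]
  simp only [Nat.add_sub_cancel, one_mul, Nat.add_le_add_iff_right]

theorem degreeLaw_apply (n k : ℕ) {u : ∀ t : StackTriangulation (n + 2), t.rep.Vertex}
    (hu : ∀ t : StackTriangulation (n + 2), t.rep.IsFirstInserted (u t)) :
    degreeLaw n u (k + 3) = ((if k ≤ n then ballot 3 k * forestCard (n - k) k else 0 : ℕ) : ENNReal) *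
      (forestCard (n + 1) 1 : ENNReal)⁻¹ := by
  rw [degreeLaw, PMF.map_apply, tsum_fintype, ← sum_root, Nat.cast_sum, Finset.sum_mul, ← card_eq]
  refine Finset.sum_congr rfl fun t _ => ?_
  rw [PMF.uniformOfFintype_apply, (hu t).degree_eq t.isLabelling]
  by_cases h : cornerCount t.tree (Sum.inr []) = k
  · rw [if_pos h, if_pos (by omega)]
    simp
  · rw [if_neg h, if_neg (by omega)]
    simp

/-- All these maps have exactly `n + 1` internal vertices, so the two successive uniform choices
amount to a uniform choice among all pairs of a map and an internal vertex. -/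
theorem internalDegreeLaw_apply (n k : ℕ) :
    internalDegreeLaw n (k + 3) =
      ((if k ≤ n then ballot 3 k * (3 * (n - k) + k).choose (n - k) else 0 : ℕ) : ENNReal) *
        ((forestCard (n + 1) 1 : ENNReal)⁻¹ * ((n + 1 : ℕ) : ENNReal)⁻¹) := by
  rw [internalDegreeLaw, PMF.bind_apply, tsum_fintype, ← sum_internal, Nat.cast_sum,
    Finset.sum_mul, ← card_eq]
  refine Finset.sum_congr rfl fun t _ => ?_
  obtain ⟨e, he⟩ := t.exists_vertexEquiv
  have hcard : Fintype.card t.InternalVertex = n + 1 := by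
    have := t.card_tree
    rw [← Fintype.card_congr e, Fintype.card_coe]
    omega
  rw [PMF.uniformOfFintype_apply, PMF.map_apply, tsum_fintype, ← Equiv.sum_comp e,
    mul_left_comm, Nat.cast_sum, Finset.sum_mul, ← Finset.sum_coe_sort t.tree]
  refine congrArg _ (Finset.sum_congr rfl fun q _ => ?_)
  rw [he, PMF.uniformOfFintype_apply, hcard]
  by_cases h : cornerCount t.tree (Sum.inr q.1) = k
  · rw [if_pos h, if_pos (by omega)]
    simp
  · rw [if_neg h, if_neg (by omega)]
    simp

end StackTriangulation

/-! ### Convergence in law -/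

/-- Fatou's lemma for the counting measure gives the lower bound on open sets in the portmanteau
theorem. One-sided bounds suffice because `q` has total mass one. -/
theorem PMF.tendsto_law {p : ℕ → PMF ℕ} {q : PMF ℕ}
    (h : ∀ k, q k ≤ liminf (fun n => p n k) atTop) :
    Tendsto (fun n => (p n).law) atTop (𝓝 q.law) := by
  refine tendsto_of_forall_isOpen_le_liminf' fun G _ => ?_
  have hm : ∀ r : PMF ℕ, (r.law : Measure ℕ) G = ∫⁻ x, G.indicator r x ∂Measure.count := by
    intro r
    rw [lintegral_count]
    exact r.toMeasure_apply (MeasurableSet.of_discrete)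
  simp only [hm]
  refine le_trans (lintegral_mono fun x => ?_)
    (lintegral_liminf_le fun n => measurable_of_countable _)
  by_cases hx : x ∈ G
  · simpa [hx] using h x
  · simp [hx]

theorem exists_pmf {f : ℕ → ℝ} (hf : ∀ k, 0 ≤ f k) (hs : HasSum f 1) :
    ∃ q : PMF ℕ, (∀ k, q (k + 3) = ENNReal.ofReal (f k)) ∧ ∀ k < 3, q k = 0 := by
  let p : PMF ℕ := ⟨fun k => ENNReal.ofReal (f k), by
    rw [ENNReal.summable.hasSum_iff, ← ENNReal.ofReal_tsum_of_nonneg hf hs.summable, hs.tsum_eq,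
      ENNReal.ofReal_one]⟩
  refine ⟨p.map (· + 3), fun k => ?_, fun k hk => ?_⟩
  · rw [PMF.map_apply, tsum_eq_single k]
    · rw [if_pos rfl]
      rfl
    · intro b hb
      rw [if_neg (by omega)]
  · rw [PMF.map_apply, ENNReal.tsum_eq_zero]
    intro b
    rw [if_neg (by omega)]

/-- A law on the integers `k + 3` to which the laws `p n` converge if the probabilities do. -/
theorem exists_limit_law {f : ℕ → ℝ} (hf : ∀ k, 0 ≤ f k) (hs : HasSum f 1) :
    ∃ q : PMF ℕ, (∀ k, (q (k + 3)).toReal = f k) ∧ ∀ p : ℕ → PMF ℕ,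
      (∀ k, Tendsto (fun n => (p n (k + 3)).toReal) atTop (𝓝 (f k))) →
      Tendsto (fun n => (p n).law) atTop (𝓝 q.law) := by
  obtain ⟨q, hq, hq0⟩ := exists_pmf hf hs
  refine ⟨q, fun k => by rw [hq, ENNReal.toReal_ofReal (hf k)], fun p hp => ?_⟩
  refine PMF.tendsto_law fun k => ?_
  by_cases hk : k < 3
  · rw [hq0 k hk]
    exact zero_le
  · obtain ⟨k, rfl⟩ : ∃ j, k = j + 3 := ⟨k - 3, by omega⟩
    have := ENNReal.tendsto_ofReal (hp k)
    simp only [ENNReal.ofReal_toReal (PMF.apply_ne_top _ _)] at this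
    rw [hq, this.liminf_eq]

/-! ### Sums of ballot numbers -/

namespace TTree

/-- The only solution of this recurrence that grows more slowly than `3 ^ j` is zero. -/
theorem eq_zero_of_recurrence {E : ℕ → ℝ} (h0 : E 0 = 0)
    (h : ∀ j, E (j + 1) = E j + 2 / 9 * E (j + 2)) (hb : ∀ j, |E j| ≤ (j + 1) * (3 / 2) ^ j) (j : ℕ) :
    E j = 0 := by
  -- The characteristic roots are 3/2 and 3, so a solution with `E 0 = 0` is a multiple of 3^j -
  -- (3/2)^j, and `E 1` fixes the multiple.
  set c : ℝ := 2 / 3 * E 1 with hc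
  have key : ∀ j, E j = c * (3 ^ j - (3 / 2) ^ j) ∧ E (j + 1) = c * (3 ^ (j + 1) - (3 / 2) ^ (j + 1)) := by
    intro j
    induction j with
    | zero =>
      constructor
      · simp [h0]
      · rw [hc]
        ring
    | succ j ih =>
      refine ⟨ih.2, ?_⟩
      have h1 := h j
      rw [ih.1, ih.2] at h1
      rw [pow_succ, pow_succ, pow_succ, pow_succ] at *
      linear_combination (-9 / 2) * h1
  have hlim : Tendsto (fun j : ℕ => c * (1 - (1 / 2 : ℝ) ^ j)) atTop (𝓝 (c * (1 - 0))) :=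
    (tendsto_const_nhds.sub (tendsto_pow_atTop_nhds_zero_of_lt_one (by norm_num)
      (by norm_num))).const_mul c
  have hlim' : Tendsto (fun j : ℕ => c * (1 - (1 / 2 : ℝ) ^ j)) atTop (𝓝 0) := by
    have hsum : Tendsto (fun j : ℕ => (j : ℝ) * (1 / 2) ^ j + (1 / 2) ^ j) atTop (𝓝 (0 + 0)) :=
      (tendsto_self_mul_const_pow_of_lt_one (by norm_num) (by norm_num)).add
        (tendsto_pow_atTop_nhds_zero_of_lt_one (by norm_num) (by norm_num))
    rw [add_zero] at hsum
    refine squeeze_zero_norm (fun j => ?_) hsum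
    have h3 : (0 : ℝ) < 3 ^ j := by positivity
    have h1 : c * (1 - (1 / 2 : ℝ) ^ j) = E j / 3 ^ j := by
      rw [(key j).1, eq_div_iff h3.ne', mul_assoc, sub_mul, ← mul_pow]
      norm_num
    have h2 : (j : ℝ) * (1 / 2) ^ j + (1 / 2) ^ j = (j + 1) * (3 / 2) ^ j / 3 ^ j := by
      rw [eq_div_iff h3.ne', ← add_one_mul, mul_assoc, ← mul_pow]
      norm_num
    rw [h1, h2, Real.norm_eq_abs, abs_div, abs_of_pos h3]
    gcongr
    exact hb j
  have hc0 := tendsto_nhds_unique hlim hlim'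
  rw [sub_zero, mul_one] at hc0
  rw [(key j).1, hc0, zero_mul]

/-- The row sums satisfy the same recurrence as `M`, which does not determine them because of the
solution growing like 3^j. Partial sums are bounded by `M`, so the defect is of order at most (j +
1)(3/2)^j and `eq_zero_of_recurrence` kills it. The source term `r` serves for the first moment. -/
theorem hasSum_of_recurrence {f r : ℕ → ℕ → ℝ} {M R : ℕ → ℝ} (hf : ∀ j k, 0 ≤ f j k)
    (hr : ∀ j k, 0 ≤ r j k) (hR : ∀ j, HasSum (r j) (R j)) (h0 : ∀ j, f (j + 1) 0 = f j 0)
    (hs : ∀ j k, f (j + 1) (k + 1) = f j (k + 1) + 2 / 9 * f (j + 2) k + r j k)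
    (hz : HasSum (f 0) (M 0)) (hM : ∀ j, M (j + 1) = M j + 2 / 9 * M (j + 2) + R j)
    (hM0 : ∀ j, 0 ≤ M j) (hb : ∀ j, M j ≤ (j + 1) * (3 / 2) ^ j) (j : ℕ) : HasSum (f j) (M j) := by
  -- By `hs`, `n + 1` terms of row `j + 1` reduce to `n + 1` terms of row `j` and `n` terms of row
  -- `j + 2`: hence the double induction.
  have bound : ∀ n j, ∑ k ∈ Finset.range n, f j k ≤ M j := by
    intro n
    induction n with
    | zero => intro j; simpa using hM0 j
    | succ n ih =>
      intro j
      induction j with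
      | zero => exact sum_le_hasSum _ (fun k _ => hf 0 k) hz
      | succ j ihj =>
        rw [Finset.sum_range_succ'] at ihj ⊢
        simp only [hs, h0, Finset.sum_add_distrib, ← Finset.mul_sum]
        have h1 := ih (j + 2)
        have h2 := sum_le_hasSum (Finset.range n) (fun k _ => hr j k) (hR j)
        rw [hM]
        linarith
  have hsum : ∀ j, Summable (f j) := fun j => summable_of_sum_range_le (hf j) fun n => bound n j
  have hle : ∀ j, ∑' k, f j k ≤ M j := fun j =>
    Real.tsum_le_of_sum_range_le (hf j) fun n => bound n j
  have hE := eq_zero_of_recurrence (E := fun j => ∑' k, f j k - M j) (by simp [hz.tsum_eq])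
    (fun j => by
      have h1 := (hsum (j + 1)).tsum_eq_zero_add
      have h2 := (hsum j).tsum_eq_zero_add
      have h3 : Summable fun k => f j (k + 1) := (hsum j).comp_injective (add_left_injective 1)
      simp only [hs, h0] at h1
      rw [Summable.tsum_add (h3.add ((hsum (j + 2)).mul_left _)) (hR j).summable,
        Summable.tsum_add h3 ((hsum (j + 2)).mul_left _), tsum_mul_left, (hR j).tsum_eq] at h1
      rw [h1, h2, hM]
      ring)
    (fun j => by
      rw [abs_sub_comm, abs_of_nonneg (sub_nonneg.2 (hle j))]
      have : 0 ≤ ∑' k, f j k := tsum_nonneg (hf j)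
      linarith [hb j]) j
  have : ∑' k, f j k = M j := sub_eq_zero.1 hE
  rw [← this]
  exact (hsum j).hasSum

theorem hasSum_ballot (j : ℕ) :
    HasSum (fun k => (ballot j k : ℝ) * (2 / 9) ^ k) ((3 / 2) ^ j) := by
  refine hasSum_of_recurrence (f := fun j k => (ballot j k : ℝ) * (2 / 9) ^ k)
    (M := fun j => (3 / 2) ^ j) (r := fun _ _ => 0) (R := fun _ => 0) (fun j k => by positivity)
    (fun _ _ => le_rfl) (fun _ => hasSum_zero) (fun j => by simp [ballot_zero]) (fun j k => ?_) ?_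
    (fun j => by ring) (fun j => by positivity) (fun j => ?_) j
  · rw [ballot_succ]
    push_cast
    ring
  · simpa [ballot_zero] using hasSum_single (f := fun k => (ballot 0 k : ℝ) * (2 / 9) ^ k) 0
      (by
        rintro (_ | k) hk
        · exact absurd rfl hk
        · simp [ballot_zero_succ])
  · have : (0 : ℝ) < (3 / 2) ^ j := by positivity
    have : (0 : ℝ) ≤ j := by positivity
    nlinarith

/-- This is x d/dx of B(x)^j at x = 2/9, where x B'(x) = 3/2. In the recurrence, shifting the weight
from `k` to `k + 1` produces the source term, summed by `hasSum_ballot`. -/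
theorem hasSum_mul_ballot (j : ℕ) :
    HasSum (fun k : ℕ => (k : ℝ) * (ballot j k * (2 / 9) ^ k)) (j * (3 / 2) ^ j) := by
  refine hasSum_of_recurrence (f := fun j k => ((k : ℕ) : ℝ) * (ballot j k * (2 / 9) ^ k))
    (M := fun j => j * (3 / 2) ^ j) (r := fun j k => 2 / 9 * (ballot (j + 2) k * (2 / 9) ^ k))
    (R := fun j => 2 / 9 * (3 / 2) ^ (j + 2)) (fun j k => by positivity)
    (fun j k => by positivity) (fun j => (hasSum_ballot (j + 2)).mul_left _) (fun j => by simp)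
    (fun j k => ?_) ?_ (fun j => by push_cast; ring) (fun j => by positivity) (fun j => ?_) j
  · rw [ballot_succ]
    push_cast
    ring
  · have : (fun k : ℕ => (k : ℝ) * (ballot 0 k * (2 / 9 : ℝ) ^ k)) = fun _ => 0 := by
      funext k
      cases k <;> simp [ballot_zero_succ]
    simp only [this, Nat.cast_zero, zero_mul]
    exact hasSum_zero
  · gcongr
    linarith

/-! ### Ratios of binomial coefficients -/

/-- Raising `c` by one when b = 0 multiplies the ratio by (3m + c + 1)/(2m + c + 1), which tends to
3/2; raising `b` multiplies it by (3m + b + c + 1)/(m + b + 1), which tends to 3. -/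
theorem tendsto_choose_ratio (b c : ℕ) :
    Tendsto (fun m : ℕ => ((3 * m + (b + c)).choose (m + b) : ℝ) / (3 * m).choose m) atTop
      (𝓝 (3 ^ b * (3 / 2) ^ c)) := by
  have step : ∀ {f g : ℕ → ℝ} {x y : ℝ} (a a' d d' : ℝ), Tendsto f atTop (𝓝 x) → d' ≠ 0 →
      x * (d / d') = y → (∀ m : ℕ, g m = f m * ((a + d * m) / (a' + d' * m))) →
      Tendsto g atTop (𝓝 y) := by
    intro f g x y a a' d d' hf hd hy hg
    rw [← hy, funext hg]
    exact hf.mul (tendsto_add_mul_div_add_mul_atTop_nhds a a' d hd)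
  induction b with
  | zero =>
    induction c with
    | zero =>
      have : ∀ m : ℕ, ((3 * m).choose m : ℝ) ≠ 0 := fun m =>
        Nat.cast_ne_zero.2 (Nat.choose_pos (by omega)).ne'
      simp [this]
    | succ c ih =>
      refine step (c + 1) (c + 1) 3 2 ih (by norm_num) (by ring) fun m => ?_
      have h := Nat.choose_mul_succ_eq (3 * m + c) m
      rw [show 3 * m + c + 1 - m = 2 * m + c + 1 by omega] at h
      have h' := congrArg (Nat.cast : ℕ → ℝ) h
      push_cast at h'
      have hpos : (c + 1 + 2 * (m : ℝ)) ≠ 0 := by positivity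
      rw [div_mul_div_comm, mul_comm _ (_ + 2 * (m : ℝ)), ← div_div, show 3 * m + (0 + (c + 1)) =
        3 * m + c + 1 by ring, zero_add, add_zero]
      congr 1
      rw [eq_div_iff hpos]
      linear_combination -h'
  | succ b ih =>
    refine step (b + c + 1) (b + 1) 3 1 ih one_ne_zero (by ring) fun m => ?_
    have h := Nat.add_one_mul_choose_eq (3 * m + (b + c)) (m + b)
    have h' := congrArg (Nat.cast : ℕ → ℝ) h
    push_cast at h'
    have hpos : (b + 1 + 1 * (m : ℝ)) ≠ 0 := by positivity
    rw [div_mul_div_comm, mul_comm _ (_ + 1 * (m : ℝ)), ← div_div, show 3 * m + (b + 1 + c) =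
      3 * m + (b + c) + 1 by ring, ← add_assoc m b 1]
    congr 1
    rw [eq_div_iff hpos]
    linear_combination -h'

theorem tendsto_choose_div_choose (k : ℕ) :
    Tendsto (fun m : ℕ => ((3 * m + k).choose m : ℝ) / (3 * (m + k + 1) + 1).choose (m + k + 1)) atTop
      (𝓝 (2 ^ (k + 3) / 3 ^ (2 * k + 4))) := by
  -- With b = k + 1 and c = 2k + 3 one has 3m + b + c = 3(m + k + 1) + 1.
  have h := (tendsto_choose_ratio 0 k).div (tendsto_choose_ratio (k + 1) (2 * k + 3)) (by positivity)
  convert h using 2 with m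
  · have hne : ((3 * m).choose m : ℝ) ≠ 0 := Nat.cast_ne_zero.2 (Nat.choose_pos (by omega)).ne'
    rw [Pi.div_apply, div_div_div_cancel_right₀ hne, zero_add, add_zero,
      show 3 * m + (k + 1 + (2 * k + 3)) = 3 * (m + k + 1) + 1 by ring, add_assoc m k 1]
  · rw [eq_div_iff (by positivity), div_pow, div_pow, div_mul_eq_mul_div, div_eq_iff (by positivity)]
    field_simp
    ring

theorem forestCard_mul_real (n j : ℕ) :
    (forestCard n j : ℝ) * (3 * n + j) = j * (3 * n + j).choose n := by
  have := congrArg (Rat.cast : ℚ → ℝ) (forestCard_mul n j)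
  push_cast at this
  exact this

theorem forestCard_pos (n : ℕ) : (0 : ℝ) < forestCard n 1 := by
  have h := forestCard_mul_real n 1
  have h2 : (0 : ℝ) < (3 * n + 1).choose n := Nat.cast_pos.2 (Nat.choose_pos (by omega))
  push_cast at h
  by_contra hn
  have h0 : (0 : ℝ) ≤ forestCard n 1 := Nat.cast_nonneg _
  have : (forestCard n 1 : ℝ) = 0 := le_antisymm (not_lt.1 hn) h0
  rw [this] at h
  linarith

/-- The denominators in `forestCard_mul` contribute k(3m + 3k + 4)/(3m + k), with limit k. -/
theorem tendsto_root (k : ℕ) :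
    Tendsto (fun m : ℕ => (forestCard m k : ℝ) / forestCard (m + k + 1) 1) atTop
      (𝓝 (k * (2 ^ (k + 3) / 3 ^ (2 * k + 4)))) := by
  have h := ((tendsto_choose_div_choose k).mul
    (tendsto_add_mul_div_add_mul_atTop_nhds (3 * k + 4 : ℝ) k 3 (d := 3) (by norm_num))).const_mul
    (k : ℝ)
  rw [div_self (by norm_num : (3 : ℝ) ≠ 0), mul_one] at h
  refine h.congr' ?_
  -- Excludes m = k = 0, where the denominator 3m + k vanishes.
  filter_upwards [eventually_gt_atTop 0] with m hm
  have h1 := forestCard_mul_real m k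
  have h2 := forestCard_mul_real (m + k + 1) 1
  have h3 := forestCard_pos (m + k + 1)
  have h4 : (0 : ℝ) < (3 * (m + k + 1) + 1).choose (m + k + 1) :=
    Nat.cast_pos.2 (Nat.choose_pos (by omega))
  have hm' : (0 : ℝ) < m := Nat.cast_pos.2 hm
  have h5 : (k + 3 * (m : ℝ)) ≠ 0 := by positivity
  push_cast at h2
  rw [eq_div_iff h3.ne']
  field_simp
  have e1 : (3 * (m : ℝ) + k) ≠ 0 := by positivity
  refine mul_left_cancel₀ e1 ?_
  linear_combination (k : ℝ) * (3 * m + k) * ((3 * m + k).choose m : ℝ) * h2 -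
    ((3 * (m + k + 1) + 1).choose (m + k + 1) : ℝ) * (3 * m + k) * h1

/-- Here the correction is (3m + 3k + 4)/(m + k + 1), with limit 3 instead of `k`. -/
theorem tendsto_internal (k : ℕ) :
    Tendsto (fun m : ℕ => ((3 * m + k).choose m : ℝ) /
      (forestCard (m + k + 1) 1 * (m + k + 1))) atTop (𝓝 (3 * (2 ^ (k + 3) / 3 ^ (2 * k + 4)))) := by
  have h := ((tendsto_choose_div_choose k).mul
    (tendsto_add_mul_div_add_mul_atTop_nhds (3 * k + 4 : ℝ) (k + 1) 3 (d := 1) (by norm_num)))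
  rw [div_one, mul_comm _ (3 : ℝ)] at h
  refine h.congr fun m => ?_
  have h2 := forestCard_mul_real (m + k + 1) 1
  have h3 := forestCard_pos (m + k + 1)
  have h4 : (0 : ℝ) < (3 * (m + k + 1) + 1).choose (m + k + 1) :=
    Nat.cast_pos.2 (Nat.choose_pos (by omega))
  have h5 : (k + 1 + 1 * (m : ℝ)) ≠ 0 := by positivity
  have h6 : (m + k + 1 : ℝ) ≠ 0 := by positivity
  push_cast at h2
  rw [div_mul_div_comm, div_eq_div_iff (by positivity) (by positivity)]
  linear_combination ((3 * m + k).choose m : ℝ) * (m + k + 1) * h2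

/-- The numbers of ballot sequences in the form in which they occur in the limit laws. -/
theorem ballot_three (k : ℕ) : (ballot 3 k : ℝ) * (k + 3) = 3 * (2 * k + 2).choose k := by
  have h := congrArg (Rat.cast : ℚ → ℝ) (ballot_mul 3 k)
  have h2 := Nat.choose_mul_succ_eq (2 * k + 2) k
  rw [show 2 * k + 2 + 1 - k = k + 3 by omega] at h2
  have h3 := congrArg (Nat.cast : ℕ → ℝ) h2
  push_cast at h h3
  have hne : (2 * (k : ℝ) + 3) ≠ 0 := by positivity
  refine mul_left_cancel₀ hne ?_
  rw [show 2 * k + 2 + 1 = 2 * k + 3 by ring] at h3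
  linear_combination (k + 3 : ℝ) * h - 3 * h3

end TTree

/-! ### The two limit laws -/

open TTree in
theorem proposition7 :
    (∃ X : PMF ℕ,
      (∀ k : ℕ, (X (k + 3)).toReal =
        (k : ℝ) / (k + 3) * ((2 * k + 2).choose k : ℝ) * (2 ^ (k + 3) / 3 ^ (2 * k + 3))) ∧
      ∀ u : ∀ (n : ℕ) (t : StackTriangulation (n + 2)), t.rep.Vertex,
        (∀ (n : ℕ) (t : StackTriangulation (n + 2)), t.rep.IsFirstInserted (u n t)) →
        Tendsto (fun n => (StackTriangulation.degreeLaw n (u n)).law) atTop (𝓝 X.law)) ∧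
    (∃ Y : PMF ℕ,
      (∀ k : ℕ, (Y (k + 3)).toReal =
        1 / ((k : ℝ) + 3) * ((2 * k + 2).choose k : ℝ) * (2 ^ (k + 3) / 3 ^ (2 * k + 2))) ∧
      Tendsto (fun n => (StackTriangulation.internalDegreeLaw n).law) atTop (𝓝 Y.law)) := by
  have hpow : ∀ k : ℕ, (2 / 9 : ℝ) ^ k = 2 ^ k / 3 ^ (2 * k) := fun k => by
    rw [div_pow, pow_mul]
    norm_num
  have hchoose : ∀ k : ℕ, ((2 * k + 2).choose k : ℝ) = ballot 3 k * (k + 3) / 3 := fun k => by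
    rw [ballot_three]
    ring
  constructor
  · have hsum : HasSum (fun k : ℕ => (k : ℝ) / (k + 3) * ((2 * k + 2).choose k : ℝ) *
        (2 ^ (k + 3) / 3 ^ (2 * k + 3))) 1 := by
      -- The constant is 2^3/3^3 times the factor 1/3 from `hchoose`.
      have h := (hasSum_mul_ballot 3).mul_right (8 / 81)
      rw [show ((3 : ℕ) : ℝ) * (3 / 2) ^ 3 * (8 / 81) = 1 by norm_num] at h
      refine Eq.mpr (congrArg (fun f : ℕ → ℝ => HasSum f 1) (funext fun k => ?_)) h
      rw [hchoose, hpow]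
      field_simp
      ring
    obtain ⟨X, hX, hlim⟩ := exists_limit_law (fun k => by positivity) hsum
    refine ⟨X, hX, fun u hu => hlim _ fun k => ?_⟩
    -- Substituting n = m + k makes `k ≤ n` automatic and turns `n - k` into `m`.
    rw [← tendsto_add_atTop_iff_nat k]
    convert (tendsto_root k).const_mul (ballot 3 k : ℝ) using 2 with m
    · rw [StackTriangulation.degreeLaw_apply _ _ (hu _), if_pos (by omega), Nat.add_sub_cancel]
      simp
      ring
    · rw [hchoose]
      field_simp
      ring
  · have hsum : HasSum (fun k : ℕ => 1 / ((k : ℝ) + 3) * ((2 * k + 2).choose k : ℝ) *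
        (2 ^ (k + 3) / 3 ^ (2 * k + 2))) 1 := by
      -- The constant is 2^3/3^2 times the factor 1/3 from `hchoose`.
      have h := (hasSum_ballot 3).mul_right (8 / 27)
      rw [show ((3 / 2 : ℝ)) ^ 3 * (8 / 27) = 1 by norm_num] at h
      refine Eq.mpr (congrArg (fun f : ℕ → ℝ => HasSum f 1) (funext fun k => ?_)) h
      rw [hchoose, hpow]
      field_simp
      ring
    obtain ⟨Y, hY, hlim⟩ := exists_limit_law (fun k => by positivity) hsum
    refine ⟨Y, hY, hlim _ fun k => ?_⟩
    rw [← tendsto_add_atTop_iff_nat k]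
    convert (tendsto_internal k).const_mul (ballot 3 k : ℝ) using 2 with m
    · rw [StackTriangulation.internalDegreeLaw_apply, if_pos (by omega), Nat.add_sub_cancel]
      rw [ENNReal.toReal_mul, ENNReal.toReal_mul, ENNReal.toReal_inv, ENNReal.toReal_inv,
        ENNReal.toReal_natCast, ENNReal.toReal_natCast, ENNReal.toReal_natCast, div_eq_mul_inv,
        mul_inv]
      push_cast
      ring
    · rw [hchoose]
      field_simp
      ring
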